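/- Let $M$ be a compact $C^1$ manifold without boundary carrying a continuous Riemannian metric, let $\mathrm{dist}$ be the Riemannian distance (equal to $\infty$ between points of different connected components), and let $f\colon M\to M$ be an Anosov diffeomorphism of class $C^1$: there are constants $K>0$, $0<\lambda<1$ and a splitting $T_xM=S_x\oplus U_x$ $(x\in M)$ into subspaces that vary continuously with $x$, with $f'_xS_x=S_{f(x)}$, $f'_xU_x=U_{f(x)}$, $\|(f^n)'_xs\|\le K\lambda^n\|s\|$ for $s\in S_x$, $n\ge 0$, and $\|(f^n)'_xu\|\le K\lambda^{-n}\|u\|$ for $u\in U_x$, $n\le 0$. A number $\rho>0$ is a constant of expansivity of $f$ if, for all $x,y\in M$, $\mathrm{dist}(f^nx,f^ny)\le\rho$ for all $n\in\mathbb Z$ if and only if $x=y$. A sequence $(y_n)_{n\in\mathbb Z}$ in $M$ is an $\alpha$-pseudo-orbit of $f$ if $\mathrm{dist}(f(y_n),y_{n+1})<\alpha$ for all $n$; it is $\beta$-shadowed by the orbit of $x$ if $\mathrm{dist}(f^n(x),y_n)\le\beta$ for all $n\in\mathbb Z$. Then $f$ has a constant of expansivity. Let $\rho$ be any such constant and let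 $0<\beta<\rho/2$. There is $\alpha>0$ such that every $\alpha$-pseudo-orbit of $f$ is $\beta$-shadowed by an orbit of $f$; let $\alpha$ be any such number. There is $\gamma$ with $0<\gamma<\min(\beta,\alpha/2)$ such that $\mathrm{dist}(x,y)<\gamma$ implies $\mathrm{dist}(f(x),f(y))<\alpha/2$; let $\gamma$ be any such number. There is a finite set $P\subset M$ that is $\gamma$-dense (for every $x\in M$ there is $p\in P$ with $\mathrm{dist}(x,p)<\gamma$); let $P$ be any such set. Give $P$ the discrete topology and $P^{\mathbb Z}$ the product topology, let $\sigma\colon P^{\mathbb Z}\to P^{\mathbb Z}$, $\sigma(q)_n=q_{n+1}$, be the shift, and let $$\Sigma(P)=\{q\in P^{\mathbb Z}:\ \mathrm{dist}(f(q_n),q_{n+1})<\alpha\ \ \forall n\in\mathbb Z\},$$ which is invariant under $\sigma$. Then for every $q\in\Sigma(P)$ there is a unique point $\theta(q)\in M$ such that $\mathrm{dist}(f^n(\theta(q)),q_n)\le\beta$ for all $n\in\mathbb Z$, and the map $\theta\colon\Sigma(P)\to M$ is a semiconjugacy of $f$ with $\sigma|_{\Sigma(P)}$: it is continuous, surjective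 and satisfies $f\circ\theta=\theta\circ\sigma|_{\Sigma(P)}$. -/

import Mathlib

open Set Topology Manifold Bundle
open scoped ContDiff

/-! ### Shadowing, expansivity, pseudo-orbits, semiconjugacies -/

/-- The bi-infinite sequence `y` `ε`-shadows the bi-infinite sequence `x`. -/
def Shadows {M : Type*} [EMetricSpace M] (ε : ℝ) (y x : ℤ → M) : Prop :=
  ∀ n : ℤ, edist (x n) (y n) ≤ ENNReal.ofReal ε

/-- The full (bi-infinite) orbit of `x` under the invertible map `f`. -/
def fullOrbit {M : Type*} (f : Equiv.Perm M) (x : M) : ℤ → M :=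
  fun n => (f ^ n) x

/-- `ρ > 0` is a constant of expansivity of `f`: two orbits that `ρ`-shadow each other agree. -/
def IsExpansivityConstant {M : Type*} [EMetricSpace M] (f : Equiv.Perm M) (ρ : ℝ) : Prop :=
  0 < ρ ∧ ∀ x y : M,
    (∀ n : ℤ, edist ((f ^ n) x) ((f ^ n) y) ≤ ENNReal.ofReal ρ) ↔ x = y

/-- `δ`-pseudo-orbits of `f`. -/
def IsPseudoOrbit {M : Type*} [EMetricSpace M] (f : M → M) (δ : ℝ) (y : ℤ → M) : Prop :=
  ∀ n : ℤ, edist (f (y n)) (y (n + 1)) < ENNReal.ofReal δ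

/-- Every `α`-pseudo-orbit of `f` is `β`-shadowed by an orbit of `f`. -/
def PseudoOrbitsShadowed {M : Type*} [EMetricSpace M] (f : Equiv.Perm M) (α β : ℝ) : Prop :=
  ∀ y : ℤ → M, IsPseudoOrbit f α y → ∃ x : M, Shadows β (fullOrbit f x) y

/-- The finite set `P` is `γ`-dense: the open balls of radius `γ` centred at `P` cover `M`. -/
def IsGammaDense {M : Type*} [EMetricSpace M] (P : Finset M) (γ : ℝ) : Prop :=
  ∀ x : M, ∃ p ∈ P, edist x p < ENNReal.ofReal γ

/-- `θ` is a semiconjugacy of `f : M → M` with `g : M' → M'`. -/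
structure IsSemiconjugacy {M M' : Type*} [TopologicalSpace M] [TopologicalSpace M']
    (f : M ≃ₜ M) (g : M' ≃ₜ M') (θ : M' → M) : Prop where
  continuous : Continuous θ
  surjective : Function.Surjective θ
  comm : ⇑f ∘ θ = θ ∘ ⇑g

/-- The shift on bi-infinite sequences, `(σ q) n = q (n + 1)`. -/
def shift (X : Type*) [TopologicalSpace X] : (ℤ → X) ≃ₜ (ℤ → X) where
  toFun q := fun n => q (n + 1)
  invFun q := fun n => q (n - 1)
  left_inv q := by funext n; simp
  right_inv q := by funext n; simp
  continuous_toFun := by fun_prop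
  continuous_invFun := by fun_prop

/-- `Σ(P)`: the `α`-pseudo-orbits of `f` formed by points of `P`, as a subspace of `P^ℤ`.
Here the finite subset `P` carries the subspace topology, which is discrete, and `P^ℤ` carries
the product topology. -/
def pseudoOrbitSpace {M : Type*} [EMetricSpace M] (f : M → M) (α : ℝ) (P : Finset M) :
    Set (ℤ → P) :=
  {q | IsPseudoOrbit f α (fun n => (q n : M))}

theorem shift_mem_pseudoOrbitSpace_iff {M : Type*} [EMetricSpace M] (f : M → M) (α : ℝ)
    (P : Finset M) (q : ℤ → P) :
    q ∈ pseudoOrbitSpace f α P ↔ shift P q ∈ pseudoOrbitSpace f α P := by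
  constructor
  · intro h n
    exact h (n + 1)
  · intro h n
    have := h (n - 1)
    simpa [shift] using this

/-- The shift restricted to `Σ(P)`. -/
def shiftOn {M : Type*} [EMetricSpace M] (f : M → M) (α : ℝ) (P : Finset M) :
    pseudoOrbitSpace f α P ≃ₜ pseudoOrbitSpace f α P :=
  (shift P).subtype (shift_mem_pseudoOrbitSpace_iff f α P)

/-! ### Anosov diffeomorphisms -/

section Anosov

variable {E : Type*} [NormedAddCommGroup E] [NormedSpace ℝ E]
  {M : Type*} [EMetricSpace M] [ChartedSpace E M] [IsManifold 𝓘(ℝ, E) 1 M]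

/-- A field of subspaces of the tangent spaces varies continuously if near every point it is
spanned by a linearly independent finite family of continuous vector fields. -/
def IsContinuousDistribution (S : ∀ x : M, Submodule ℝ (TangentSpace 𝓘(ℝ, E) x)) : Prop :=
  ∀ x₀ : M, ∃ W ∈ 𝓝 x₀, ∃ k : ℕ, ∃ X : Fin k → ∀ x : M, TangentSpace 𝓘(ℝ, E) x,
    (∀ i, ContinuousOn (fun x => (⟨x, X i x⟩ : TangentBundle 𝓘(ℝ, E) M)) W) ∧
    ∀ x ∈ W, LinearIndependent ℝ (fun i => X i x) ∧
      Submodule.span ℝ (Set.range fun i => X i x) = S x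

variable [RiemannianBundle (fun x : M => TangentSpace 𝓘(ℝ, E) x)]

/-- `f` is an Anosov diffeomorphism: the tangent bundle splits continuously and `f`-invariantly
into a subbundle `S` contracted by the forward iterates of `f` and a subbundle `U` contracted by
the backward iterates. -/
def IsAnosov (f : M ≃ₘ^1⟮𝓘(ℝ, E), 𝓘(ℝ, E)⟯ M) : Prop :=
  ∃ K lam : ℝ, 0 < K ∧ 0 < lam ∧ lam < 1 ∧
  ∃ S U : ∀ x : M, Submodule ℝ (TangentSpace 𝓘(ℝ, E) x),
    IsContinuousDistribution S ∧ IsContinuousDistribution U ∧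
    (∀ x, IsCompl (S x) (U x)) ∧
    (∀ x, (S x).map (mfderiv 𝓘(ℝ, E) 𝓘(ℝ, E) f x).toLinearMap = S (f x)) ∧
    (∀ x, (U x).map (mfderiv 𝓘(ℝ, E) 𝓘(ℝ, E) f x).toLinearMap = U (f x)) ∧
    (∀ (x : M) (n : ℤ), 0 ≤ n → ∀ s ∈ S x,
      ‖mfderiv 𝓘(ℝ, E) 𝓘(ℝ, E) (⇑((f.toEquiv : Equiv.Perm M) ^ n)) x s‖
        ≤ K * lam ^ n * ‖s‖) ∧
    (∀ (x : M) (n : ℤ), n ≤ 0 → ∀ u ∈ U x,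
      ‖mfderiv 𝓘(ℝ, E) 𝓘(ℝ, E) (⇑((f.toEquiv : Equiv.Perm M) ^ n)) x u‖
        ≤ K * lam ^ (-n) * ‖u‖)

end Anosov

open Filter Metric

/-! ### Contractions on spaces of sequences -/

/-! Shadowing and expansivity are the existence and the uniqueness of a fixed point of one
contraction on sequences. Replace `f` by a large iterate `g`. Read in finitely many charts, the
derivative of `g` contracts the stable directions and that of its inverse contracts the unstable
ones, each followed by the relevant projection and with norm below 1/4; this is a `HyperbolicAtlas`.
Along a pseudo-orbit `y`, `hyperbolicTransform` sends a sequence `v` of chart vectors near `y` to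
the sequence whose stable component at `n` comes from the image of `v (n - 1)` under `g`, and whose
unstable component comes from the image of `v (n + 1)` under the inverse of `g`. It halves uniform
distances on a product of small balls and preserves that product when the jumps of `y` are small. At
a fixed point the error of `g` has no stable component and the error of its inverse no unstable one;
together these force both errors to vanish (`apply_symm_eq_of_fixed`), so fixed points are orbits.
All scales are uniform by compactness: a pair `(p, q)` with `g p` close to `q` is close to the graph
of `g`, so estimates near points of the graph suffice (`forall_pair`). Expansivity of `g` gives that
of `f` at once; shadowing passes to `f` by uniform continuity of the iterates between multiples of
`N`. In the symbolic model, `2 * β < ρ` makes the shadowing point unique. The graph of `θ` is then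
cut out by closed conditions, and `M` is compact, so `θ` is continuous. Rounding an orbit to points
of `P` gives surjectivity; uniqueness gives equivariance. -/

theorem exists_fixed_of_contracting {κ E : Type*} [MetricSpace E] [CompleteSpace E]
    {T : (κ → E) → κ → E} {c : κ → E} {r : ℝ}
    (hT : ∀ (u v : κ → E) (D : ℝ), (∀ n, u n ∈ closedBall (c n) r) →
      (∀ n, v n ∈ closedBall (c n) r) → (∀ n, dist (u n) (v n) ≤ D) →
      ∀ n, dist (T u n) (T v n) ≤ D / 2)
    (hr : 0 ≤ r) (h0 : ∀ n, dist (T c n) (c n) ≤ r / 2) :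
    ∃ v : κ → E, (∀ n, v n ∈ closedBall (c n) r) ∧ T v = v := by
  have hc : ∀ n, c n ∈ closedBall (c n) r := fun n => mem_closedBall_self hr
  have hmaps : ∀ u : κ → E, (∀ n, u n ∈ closedBall (c n) r) →
      ∀ n, T u n ∈ closedBall (c n) r := fun u hu n => by
    -- The radius splits evenly: `r / 2` from contraction towards the image of the centre, `r / 2`
    -- from the displacement of the centre itself.
    have h1 := hT u c r hu hc (fun n => hu n) n
    have h2 := h0 n
    have h3 := dist_triangle (T u n) (T c n) (c n)
    rw [mem_closedBall]
    linarith
  let w : ℕ → κ → E := fun k => T^[k] c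
  have hw_succ : ∀ k, w (k + 1) = T (w k) := fun k => Function.iterate_succ_apply' T k c
  have hw : ∀ k n, w k n ∈ closedBall (c n) r := by
    intro k
    induction k with
    | zero => exact hc
    | succ k ih => rw [hw_succ]; exact hmaps _ ih
  have hd : ∀ k n, dist (w k n) (w (k + 1) n) ≤ r / 2 / 2 ^ k := by
    intro k
    induction k with
    | zero =>
      intro n
      simpa [w, dist_comm] using h0 n
    | succ k ih =>
      intro n
      have := hT (w k) (w (k + 1)) _ (hw k) (hw (k + 1)) ih n
      rw [← hw_succ, ← hw_succ] at this
      calc _ ≤ _ := this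
        _ = _ := by rw [pow_succ]; ring
  have hcau : ∀ n, CauchySeq fun k => w k n := fun n =>
    cauchySeq_of_le_geometric_two fun k => hd k n
  choose v hv using fun n => cauchySeq_tendsto_of_complete (hcau n)
  have hvb : ∀ n, v n ∈ closedBall (c n) r := fun n =>
    isClosed_closedBall.mem_of_tendsto (hv n) (Eventually.of_forall fun k => hw k n)
  have hdv : ∀ k n, dist (w k n) (v n) ≤ r / 2 ^ k := fun k n =>
    dist_le_of_le_geometric_two_of_tendsto (fun k => hd k n) (hv n) k
  refine ⟨v, hvb, funext fun n => ?_⟩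
  -- `T` is controlled only by bounds uniform in the index. The bound `hdv` is uniform, so
  -- coordinatewise convergence of the iterates passes through `T`.
  have hlim : Tendsto (fun k => w (k + 1) n) atTop (𝓝 (T v n)) := by
    rw [tendsto_iff_dist_tendsto_zero]
    refine squeeze_zero (fun _ => dist_nonneg) (g := fun k : ℕ => r / 2 ^ k / 2) (fun k => ?_) ?_
    · rw [hw_succ]
      exact hT _ _ _ (hw k) hvb (hdv k) n
    · have : Tendsto (fun k : ℕ => r / 2 * (1 / 2 : ℝ) ^ k) atTop (𝓝 (r / 2 * 0)) :=
        (tendsto_pow_atTop_nhds_zero_of_lt_one (by norm_num) (by norm_num)).const_mul _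
      rw [mul_zero] at this
      refine this.congr fun k => ?_
      rw [one_div, inv_pow]
      ring
  exact tendsto_nhds_unique hlim ((tendsto_add_atTop_iff_nat 1).2 (hv n))

theorem fixed_unique_of_contracting {κ E : Type*} [MetricSpace E]
    {T : (κ → E) → κ → E} {c : κ → E} {r : ℝ}
    (hT : ∀ (u v : κ → E) (D : ℝ), (∀ n, u n ∈ closedBall (c n) r) →
      (∀ n, v n ∈ closedBall (c n) r) → (∀ n, dist (u n) (v n) ≤ D) →
      ∀ n, dist (T u n) (T v n) ≤ D / 2)
    {u v : κ → E} (hu : ∀ n, u n ∈ closedBall (c n) r) (hv : ∀ n, v n ∈ closedBall (c n) r)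
    (hTu : T u = u) (hTv : T v = v) : u = v := by
  have hd : ∀ (k : ℕ) n, dist (u n) (v n) ≤ 2 * r * (1 / 2 : ℝ) ^ k := by
    intro k
    induction k with
    | zero =>
      intro n
      have h1 := mem_closedBall.1 (hu n)
      have h2 := mem_closedBall'.1 (hv n)
      have h3 := dist_triangle (u n) (c n) (v n)
      simp only [pow_zero]
      linarith
    | succ k ih =>
      intro n
      have := hT u v _ hu hv ih n
      rw [hTu, hTv] at this
      rw [pow_succ]
      linarith
  funext n
  have hlim : Tendsto (fun k : ℕ => 2 * r * (1 / 2 : ℝ) ^ k) atTop (𝓝 (2 * r * 0)) :=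
    (tendsto_pow_atTop_nhds_zero_of_lt_one (by norm_num) (by norm_num)).const_mul _
  rw [mul_zero] at hlim
  exact dist_le_zero.1 (ge_of_tendsto' hlim fun k => hd k n)

/-! ### Local consequences of strict differentiability -/

section Local

variable {E : Type*} [NormedAddCommGroup E] [NormedSpace ℝ E]
  {X : Type*} {l : Filter X} {Q R : X → E →L[ℝ] E} {Q₀ R₀ B D : E →L[ℝ] E} {F : E → E} {a : E}

/-- The error splits into `Q` applied to the strict differentiability remainder, and `Q - Q₀`
applied to the linear part. `Q` varies with a parameter because the projections depend on the base
point. -/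
theorem HasStrictFDerivAt.eventually_norm_sub_le (hF : HasStrictFDerivAt F B a)
    (hQ : Tendsto Q l (𝓝 Q₀)) {ε : ℝ} (hε : 0 < ε) :
    ∀ᶠ z : X × E × E in l ×ˢ 𝓝 (a, a),
      ‖Q z.1 (F z.2.1 - F z.2.2) - Q₀ (B (z.2.1 - z.2.2))‖ ≤ ε * ‖z.2.1 - z.2.2‖ := by
  set C : ℝ := ‖Q₀‖ + 1
  have hC : 0 < C := by positivity
  have h1 : ∀ᶠ x in l, ‖Q x‖ < C := hQ.norm.eventually_lt_const (by simp [C])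
  have h2 : ∀ᶠ x in l, ‖(Q x - Q₀) ∘L B‖ < ε / 2 := by
    have hcont : Continuous fun A : E →L[ℝ] E => ‖(A - Q₀) ∘L B‖ := by fun_prop
    have : Tendsto (fun x => ‖(Q x - Q₀) ∘L B‖) l (𝓝 ‖(Q₀ - Q₀) ∘L B‖) :=
      (hcont.tendsto Q₀).comp hQ
    refine this.eventually_lt_const ?_
    simpa using half_pos hε
  have h3 := hF.isLittleO.def (c := ε / (2 * C)) (by positivity)
  filter_upwards [(h1.and h2).prod_mk h3] with ⟨x, v, w⟩ ⟨⟨hx1, hx2⟩, hx3⟩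
  simp only at hx1 hx2 hx3 ⊢
  have e : Q x (F v - F w) - Q₀ (B (v - w))
      = Q x (F v - F w - B (v - w)) + ((Q x - Q₀) ∘L B) (v - w) := by
    simp only [map_sub, ContinuousLinearMap.comp_apply, sub_apply]
    abel
  calc _ ≤ ‖Q x (F v - F w - B (v - w))‖ + ‖((Q x - Q₀) ∘L B) (v - w)‖ := e ▸ norm_add_le _ _
    _ ≤ C * (ε / (2 * C) * ‖v - w‖) + ε / 2 * ‖v - w‖ := by
      gcongr
      · exact (Q x).le_of_opNorm_le_of_le hx1.le hx3
      · exact ContinuousLinearMap.le_of_opNorm_le _ hx2.le _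
    _ = _ := by field_simp; ring

theorem HasStrictFDerivAt.eventually_norm_le (hF : HasStrictFDerivAt F B a)
    (hQ : Tendsto Q l (𝓝 Q₀)) {κ : ℝ} (hκ : ‖Q₀ ∘L B‖ < κ) :
    ∀ᶠ z : X × E × E in l ×ˢ 𝓝 (a, a),
      ‖Q z.1 (F z.2.1 - F z.2.2)‖ ≤ κ * ‖z.2.1 - z.2.2‖ := by
  filter_upwards [hF.eventually_norm_sub_le hQ (sub_pos.2 hκ)] with ⟨x, v, w⟩ h
  have h2 := (Q₀ ∘L B).le_opNorm (v - w)
  have h3 := norm_le_norm_sub_add (Q x (F v - F w)) (Q₀ (B (v - w)))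
  simp only [ContinuousLinearMap.comp_apply] at h h2 ⊢
  linarith

/-- The two algebraic hypotheses split `v - w` as `D (Q₀ (B (v - w))) + R₀ (v - w)`. Up to a small
multiple of `‖v - w‖`, the two vanishing conditions say that `Q₀ (B (v - w))` and `R₀ (v - w)` are
zero. -/
theorem HasStrictFDerivAt.eventually_eq_of_apply_eq_zero (hF : HasStrictFDerivAt F B a)
    (hQ : Tendsto Q l (𝓝 Q₀)) (hR : Tendsto R l (𝓝 R₀)) (hD : D ∘L B = 1)
    (hcomm : Q₀ ∘L B = B ∘L (1 - R₀)) :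
    ∀ᶠ z : X × E × E in l ×ˢ 𝓝 (a, a),
      Q z.1 (F z.2.1 - F z.2.2) = 0 → R z.1 (z.2.1 - z.2.2) = 0 → z.2.1 = z.2.2 := by
  -- Chosen so that `‖D‖ * ε + ε = 1 / 2`, which leaves `‖v - w‖ ≤ ‖v - w‖ / 2`.
  set ε : ℝ := 1 / (2 * (‖D‖ + 1))
  have hε : 0 < ε := by positivity
  have h1 := hF.eventually_norm_sub_le hQ hε
  have h2 := (hasStrictFDerivAt_id (𝕜 := ℝ) a).eventually_norm_sub_le hR hε
  filter_upwards [h1, h2] with ⟨x, v, w⟩ h1 h2 h3 h4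
  simp only [id, ContinuousLinearMap.id_apply] at h1 h2 h3 h4 ⊢
  rw [h3, zero_sub, norm_neg] at h1
  rw [h4, zero_sub, norm_neg] at h2
  have e : v - w = D (Q₀ (B (v - w))) + R₀ (v - w) := by
    have e1 := DFunLike.congr_fun hcomm (v - w)
    have e2 := fun z => DFunLike.congr_fun hD z
    simp only [ContinuousLinearMap.comp_apply, sub_apply,
      one_apply_eq_self] at e1 e2
    rw [e1, e2]
    abel
  have h5 : ‖v - w‖ ≤ ‖D‖ * (ε * ‖v - w‖) + ε * ‖v - w‖ :=
    calc ‖v - w‖ ≤ ‖D (Q₀ (B (v - w)))‖ + ‖R₀ (v - w)‖ := by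
          conv_lhs => rw [e]
          exact norm_add_le _ _
      _ ≤ _ := add_le_add (D.le_opNorm_of_le h1) h2
  have h6 : ‖D‖ * (ε * ‖v - w‖) + ε * ‖v - w‖ = ‖v - w‖ / 2 := by
    simp only [ε]; field_simp
  rw [h6] at h5
  exact sub_eq_zero.1 (norm_le_zero_iff.1 (by linarith))

end Local

/-- Continuity of the centres keeps small balls around them inside a fixed neighbourhood. Treating
the radius as a variable near 0 prepares the compactness argument that makes it uniform. -/
theorem eventually_forall_mem_closedBall {X E : Type*} [NormedAddCommGroup E] [TopologicalSpace X] {x₀ : X} {c d : X → E}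
    (hc : ContinuousAt c x₀) (hd : ContinuousAt d x₀) {A : X → E → E → Prop}
    (hA : ∀ᶠ z : X × E × E in 𝓝 x₀ ×ˢ 𝓝 (c x₀, d x₀), A z.1 z.2.1 z.2.2) :
    ∀ᶠ z : ℝ × X in 𝓝 (0, x₀),
      ∀ v ∈ closedBall (c z.2) z.1, ∀ w ∈ closedBall (d z.2) z.1, A z.2 v w := by
  obtain ⟨pa, ha, pb, hb, hab⟩ := eventually_prod_iff.1 hA
  obtain ⟨ε, hε, hball⟩ := Metric.eventually_nhds_iff.1 hb
  have h1 : ∀ᶠ z : ℝ × X in 𝓝 (0, x₀), z.1 < ε / 2 :=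
    continuous_fst.continuousAt.eventually_lt_const (half_pos hε)
  have h2 : ∀ᶠ z : ℝ × X in 𝓝 (0, x₀), pa z.2 ∧ dist (c z.2) (c x₀) < ε / 2 ∧
      dist (d z.2) (d x₀) < ε / 2 :=
    (continuous_snd.tendsto ((0 : ℝ), x₀)).eventually (ha.and
      ((hc.eventually (ball_mem_nhds _ (half_pos hε))).and
        (hd.eventually (ball_mem_nhds _ (half_pos hε)))))
  filter_upwards [h1, h2] with ⟨δ, x⟩ hδ ⟨hx, hcx, hdx⟩ v hv w hw
  refine hab hx (y := (v, w)) (hball ?_)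
  rw [mem_closedBall] at hv hw
  simp only at *
  rw [Prod.dist_eq, max_lt_iff]
  constructor
  · linarith [dist_triangle v (c x) (c x₀)]
  · linarith [dist_triangle w (d x) (d x₀)]

/-! ### Hyperbolic atlases -/

/-- A finite family of charts `φ i` of `M`, with compact sets `W i` covering `M` and continuous
families of projections `P i`, in which the homeomorphism `g` is strongly hyperbolic: read in the
charts it is strictly differentiable, its derivative commutes with the projections, contracts the
range of the projections and expands their kernels. -/
structure HyperbolicAtlas {M E ι : Type*} [TopologicalSpace M] [NormedAddCommGroup E]
    [NormedSpace ℝ E] (g : M ≃ₜ M) (φ : ι → OpenPartialHomeomorph M E) (W : ι → Set M)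
    (P : ι → M → E →L[ℝ] E) : Prop where
  isCompact : ∀ i, IsCompact (W i)
  subset_source : ∀ i, W i ⊆ (φ i).source
  cover : ∀ x, ∃ i, x ∈ W i
  continuousAt : ∀ i, ∀ x ∈ W i, ContinuousAt (P i) x
  idem : ∀ i, ∀ x ∈ W i, P i x ∘L P i x = P i x
  exists_deriv : ∀ i j x, x ∈ W i → g x ∈ W j → ∃ B D : E →L[ℝ] E,
    HasStrictFDerivAt (φ j ∘ g ∘ (φ i).symm) B (φ i x) ∧
    HasStrictFDerivAt (φ i ∘ g.symm ∘ (φ j).symm) D (φ j (g x)) ∧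
    D ∘L B = 1 ∧ P j (g x) ∘L B = B ∘L P i x ∧
    ‖P j (g x) ∘L B‖ < 1 / 4 ∧ ‖(1 - P i x) ∘L D‖ < 1 / 4

/-! ### Uniform estimates by compactness -/

section

variable {M E ι : Type*} [EMetricSpace M] [NormedAddCommGroup E] [NormedSpace ℝ E]
  {g : M ≃ₜ M} {φ : ι → OpenPartialHomeomorph M E} {W : ι → Set M} {P : ι → M → E →L[ℝ] E}

theorem IsCompact.eventually_forall_index {κ X : Type*} [Finite κ] [TopologicalSpace X]
    {Z : κ → Set X} (hZ : ∀ i, IsCompact (Z i)) {R : κ → ℝ → X → Prop} {t : ℝ}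
    (h : ∀ i, ∀ x ∈ Z i, ∀ᶠ z : ℝ × X in 𝓝 (t, x), R i z.1 z.2) :
    ∀ᶠ δ in 𝓝 t, ∀ i, ∀ x ∈ Z i, R i δ x :=
  eventually_all.2 fun i => (hZ i).eventually_forall_of_forall_eventually (h i)

theorem exists_pos_of_eventually_nhds_zero {p : ℝ → Prop} (h : ∀ᶠ δ in 𝓝 0, p δ) :
    ∃ δ > 0, p δ := by
  obtain ⟨δ, h1, h2⟩ :=
    ((h.filter_mono nhdsWithin_le_nhds).and (self_mem_nhdsWithin (a := (0 : ℝ)) (s := Ioi 0))).exists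
  exact ⟨δ, h2, h1⟩

theorem eventually_edist_lt_imp {X : Type*} [TopologicalSpace X] {a b : X → M} {x₀ : X}
    (ha : ContinuousAt a x₀) (hb : ContinuousAt b x₀) (hne : a x₀ ≠ b x₀) :
    ∀ᶠ z : ℝ × X in 𝓝 (0, x₀), ¬ edist (a z.2) (b z.2) < ENNReal.ofReal z.1 := by
  have hab : ContinuousAt (fun x => edist (a x) (b x)) x₀ :=
    Filter.Tendsto.edist ha hb
  have h1 : Tendsto (fun z : ℝ × X => edist (a z.2) (b z.2)) (𝓝 (0, x₀))
      (𝓝 (edist (a x₀) (b x₀))) := hab.tendsto.comp (continuous_snd.tendsto ((0 : ℝ), x₀))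
  have h2 : Tendsto (fun z : ℝ × X => ENNReal.ofReal z.1) (𝓝 (0, x₀)) (𝓝 (ENNReal.ofReal 0)) :=
    (ENNReal.continuous_ofReal.comp continuous_fst).tendsto ((0 : ℝ), x₀)
  rw [ENNReal.ofReal_zero] at h2
  have h3 : (0 : ENNReal) < edist (a x₀) (b x₀) := edist_pos.2 hne
  filter_upwards [h2.eventually_lt h1 h3] with z hz using not_lt.2 hz.le

namespace HyperbolicAtlas

variable (H : HyperbolicAtlas g φ W P)
include H

/-- On the compact set `W i ×ˢ W j`, a point off the graph of `g` has a neighbourhood where the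
premise fails for small `δ`. Only points with `q = g p` need an argument. -/
theorem forall_pair [Finite ι] {R : ι → ι → ℝ → M × M → Prop}
    (h : ∀ i j, ∀ p ∈ W i, g p ∈ W j → ∀ᶠ z : ℝ × M × M in 𝓝 (0, p, g p), R i j z.1 z.2) :
    ∀ᶠ δ in 𝓝 (0 : ℝ), ∀ i j, ∀ p ∈ W i, ∀ q ∈ W j, edist (g p) q < ENNReal.ofReal δ →
      R i j δ (p, q) := by
  have := IsCompact.eventually_forall_index (κ := ι × ι) (Z := fun k => W k.1 ×ˢ W k.2) (t := 0)
    (R := fun k δ z => edist (g z.1) z.2 < ENNReal.ofReal δ → R k.1 k.2 δ z)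
    (fun k => (H.isCompact _).prod (H.isCompact _)) ?_
  · filter_upwards [this] with δ hδ i j p hp q hq using hδ (i, j) (p, q) ⟨hp, hq⟩
  · rintro ⟨i, j⟩ ⟨p, q⟩ ⟨hp, hq⟩
    by_cases hpq : g p = q
    · subst hpq
      filter_upwards [h i j p hp hq] with z hz _ using hz
    · filter_upwards [eventually_edist_lt_imp (x₀ := (p, q)) (a := fun z : M × M => g z.1)
        (b := fun z : M × M => z.2) (by fun_prop) (by fun_prop) hpq] with z hz hz'
      exact absurd hz' hz

theorem continuousAt_chart {i : ι} {p : M} (hp : p ∈ W i) : ContinuousAt (φ i) p :=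
  (φ i).continuousAt (H.subset_source i hp)

theorem continuousAt_symm {i : ι} {p : M} (hp : p ∈ W i) : ContinuousAt (φ i).symm (φ i p) :=
  (φ i).continuousAt_symm ((φ i).map_source (H.subset_source i hp))

theorem symm_apply {i : ι} {p : M} (hp : p ∈ W i) : (φ i).symm (φ i p) = p :=
  (φ i).left_inv (H.subset_source i hp)

theorem eventually_hyperbolic [Finite ι] :
    ∀ᶠ δ in 𝓝 (0 : ℝ), ∀ i j, ∀ p ∈ W i, ∀ q ∈ W j, edist (g p) q < ENNReal.ofReal δ →
      (∀ v ∈ closedBall (φ i p) δ, ∀ w ∈ closedBall (φ i p) δ,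
        ‖P j q (φ j (g ((φ i).symm v)) - φ j (g ((φ i).symm w)))‖ ≤ 1 / 4 * ‖v - w‖) ∧
      (∀ v ∈ closedBall (φ j q) δ, ∀ w ∈ closedBall (φ j q) δ,
        ‖(1 - P i p) (φ i (g.symm ((φ j).symm v)) - φ i (g.symm ((φ j).symm w)))‖
          ≤ 1 / 4 * ‖v - w‖) ∧
      (∀ v ∈ closedBall (φ i p) δ, ∀ w ∈ closedBall (φ j q) δ,
        P j q (w - φ j (g ((φ i).symm v))) = 0 →
        (1 - P i p) (φ i (g.symm ((φ j).symm w)) - v) = 0 →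
        g ((φ i).symm v) = (φ j).symm w) := by
  refine H.forall_pair (R := fun i j δ z =>
      (∀ v ∈ closedBall (φ i z.1) δ, ∀ w ∈ closedBall (φ i z.1) δ,
        ‖P j z.2 (φ j (g ((φ i).symm v)) - φ j (g ((φ i).symm w)))‖ ≤ 1 / 4 * ‖v - w‖) ∧
      (∀ v ∈ closedBall (φ j z.2) δ, ∀ w ∈ closedBall (φ j z.2) δ,
        ‖(1 - P i z.1) (φ i (g.symm ((φ j).symm v)) - φ i (g.symm ((φ j).symm w)))‖
          ≤ 1 / 4 * ‖v - w‖) ∧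
      (∀ v ∈ closedBall (φ i z.1) δ, ∀ w ∈ closedBall (φ j z.2) δ,
        P j z.2 (w - φ j (g ((φ i).symm v))) = 0 →
        (1 - P i z.1) (φ i (g.symm ((φ j).symm w)) - v) = 0 →
        g ((φ i).symm v) = (φ j).symm w)) fun i j p hp hq => ?_
  obtain ⟨B, D, hB, hD, hDB, hcomm, hnB, hnD⟩ := H.exists_deriv i j p hp hq
  have hci : ContinuousAt (fun z : M × M => φ i z.1) (p, g p) :=
    (H.continuousAt_chart hp).comp (x := (p, g p)) continuousAt_fst
  have hcj : ContinuousAt (fun z : M × M => φ j z.2) (p, g p) :=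
    (H.continuousAt_chart hq).comp (x := (p, g p)) continuousAt_snd
  have hPj : ContinuousAt (fun z : M × M => P j z.2) (p, g p) :=
    (H.continuousAt j _ hq).comp (x := (p, g p)) continuousAt_snd
  have hPi : ContinuousAt (fun z : M × M => 1 - P i z.1) (p, g p) :=
    continuousAt_const.sub ((H.continuousAt i _ hp).comp (x := (p, g p)) continuousAt_fst)
  have e1 := eventually_forall_mem_closedBall hci hci
    (A := fun z v w => ‖P j z.2 (φ j (g ((φ i).symm v)) - φ j (g ((φ i).symm w)))‖
      ≤ 1 / 4 * ‖v - w‖) (hB.eventually_norm_le hPj hnB)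
  have e2 := eventually_forall_mem_closedBall hcj hcj
    (A := fun z v w =>
      ‖(1 - P i z.1) (φ i (g.symm ((φ j).symm v)) - φ i (g.symm ((φ j).symm w)))‖
      ≤ 1 / 4 * ‖v - w‖) (hD.eventually_norm_le hPi hnD)
  -- Here `Q` is the stable projection at the image point and `R` the unstable projection at the
  -- source point.
  have hF := hB.eventually_eq_of_apply_eq_zero hPj hPi hDB (by
    simpa only [sub_sub_cancel] using hcomm)
  have e3 : ∀ᶠ z : (M × M) × E × E in 𝓝 (p, g p) ×ˢ 𝓝 (φ i p, φ j (g p)),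
      P j z.1.2 (z.2.2 - φ j (g ((φ i).symm z.2.1))) = 0 →
        (1 - P i z.1.1) (φ i (g.symm ((φ j).symm z.2.2)) - z.2.1) = 0 →
        g ((φ i).symm z.2.1) = (φ j).symm z.2.2 := by
    have hG : ContinuousAt (fun w => g.symm ((φ j).symm w)) (φ j (g p)) :=
      g.symm.continuous.continuousAt.comp (H.continuousAt_symm hq)
    have hGp : g.symm ((φ j).symm (φ j (g p))) = p := by rw [H.symm_apply hq]; simp
    have hφG : ContinuousAt (fun w => φ i (g.symm ((φ j).symm w))) (φ j (g p)) :=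
      ContinuousAt.comp (g := φ i) (by rw [hGp]; exact H.continuousAt_chart hp) hG
    -- Injectivity is applied to the pair formed by `w` pulled back by `g` to chart `i`, and `v`.
    -- The chart expression of `g` sends the first vector to `w`, so both vanishing conditions take
    -- the required form.
    have t1 : Tendsto (fun z : (M × M) × E × E =>
        (z.1, φ i (g.symm ((φ j).symm z.2.2)), z.2.1))
        (𝓝 (p, g p) ×ˢ 𝓝 (φ i p, φ j (g p))) (𝓝 (p, g p) ×ˢ 𝓝 (φ i p, φ i p)) := by
      refine tendsto_fst.prodMk ?_
      rw [nhds_prod_eq (x := φ i p) (y := φ i p)]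
      have t2 := hφG.tendsto
      rw [hGp] at t2
      have hsnd := tendsto_snd (f := 𝓝 (p, g p)) (g := 𝓝 (φ i p, φ j (g p)))
      exact (t2.comp ((continuous_snd.tendsto _).comp hsnd)).prodMk
        ((continuous_fst.tendsto _).comp hsnd)
    have s1 : ∀ᶠ w in 𝓝 (φ j (g p)), w ∈ (φ j).target :=
      (φ j).open_target.mem_nhds ((φ j).map_source (H.subset_source j hq))
    have s2 : ∀ᶠ w in 𝓝 (φ j (g p)), g.symm ((φ j).symm w) ∈ (φ i).source := by
      refine hG.eventually ?_
      simp only [hGp]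
      exact (φ i).open_source.mem_nhds (H.subset_source i hp)
    have hsnd := (continuous_snd.tendsto (φ i p, φ j (g p))).comp
      (tendsto_snd (f := 𝓝 (p, g p)) (g := 𝓝 (φ i p, φ j (g p))))
    filter_upwards [t1.eventually hF, hsnd.eventually (s1.and s2)]
      with ⟨z, v, w⟩ hz ⟨hw1, hw2⟩ h1 h2
    simp only [Function.comp_apply] at hz hw1 hw2 h1 h2 ⊢
    rw [(φ i).left_inv hw2, g.apply_symm_apply, (φ j).right_inv hw1] at hz
    rw [← hz h1 h2, (φ i).left_inv hw2, g.apply_symm_apply]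
  have e3' := eventually_forall_mem_closedBall hci hcj
    (A := fun z v w => P j z.2 (w - φ j (g ((φ i).symm v))) = 0 →
        (1 - P i z.1) (φ i (g.symm ((φ j).symm w)) - v) = 0 →
        g ((φ i).symm v) = (φ j).symm w) e3
  filter_upwards [e1, e2, e3'] with z h1 h2 h3 using ⟨h1, h2, h3⟩

/-- Both quantities are continuous and vanish on the graph. They bound the displacement of a
pseudo-orbit under the transform. -/
theorem eventually_defect [Finite ι] {ε : ℝ} (hε : 0 < ε) :
    ∀ᶠ δ in 𝓝 (0 : ℝ), ∀ i j, ∀ p ∈ W i, ∀ q ∈ W j, edist (g p) q < ENNReal.ofReal δ →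
      ‖P j q (φ j (g p) - φ j q)‖ ≤ ε ∧ ‖(1 - P i p) (φ i (g.symm q) - φ i p)‖ ≤ ε := by
  refine H.forall_pair (R := fun i j δ z =>
    ‖P j z.2 (φ j (g z.1) - φ j z.2)‖ ≤ ε ∧ ‖(1 - P i z.1) (φ i (g.symm z.2) - φ i z.1)‖ ≤ ε)
    fun i j p hp hq => ?_
  have hci : ContinuousAt (fun z : M × M => φ i z.1) (p, g p) :=
    (H.continuousAt_chart hp).comp (x := (p, g p)) continuousAt_fst
  have hcj : ContinuousAt (fun z : M × M => φ j z.2) (p, g p) :=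
    (H.continuousAt_chart hq).comp (x := (p, g p)) continuousAt_snd
  have hPj : ContinuousAt (fun z : M × M => P j z.2) (p, g p) :=
    (H.continuousAt j _ hq).comp (x := (p, g p)) continuousAt_snd
  have hPi : ContinuousAt (fun z : M × M => 1 - P i z.1) (p, g p) :=
    continuousAt_const.sub ((H.continuousAt i _ hp).comp (x := (p, g p)) continuousAt_fst)
  have hgj : ContinuousAt (fun z : M × M => φ j (g z.1)) (p, g p) :=
    ContinuousAt.comp (g := φ j) (x := (p, g p)) (f := fun z : M × M => g z.1)
      (H.continuousAt_chart hq) (by fun_prop)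
  have hgi : ContinuousAt (fun z : M × M => φ i (g.symm z.2)) (p, g p) :=
    ContinuousAt.comp (g := φ i) (x := (p, g p)) (f := fun z : M × M => g.symm z.2)
      (by simpa using H.continuousAt_chart hp) (by fun_prop)
  have c1 : ContinuousAt (fun z : M × M => ‖P j z.2 (φ j (g z.1) - φ j z.2)‖) (p, g p) :=
    (hPj.clm_apply (hgj.sub hcj)).norm
  have c2 : ContinuousAt (fun z : M × M => ‖(1 - P i z.1) (φ i (g.symm z.2) - φ i z.1)‖)
      (p, g p) := (hPi.clm_apply (hgi.sub hci)).norm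
  have h1 := c1.eventually_lt_const (u := ε) (by simpa using hε)
  have h2 := c2.eventually_lt_const (u := ε) (by simpa using hε)
  filter_upwards [(continuous_snd.tendsto ((0 : ℝ), (p, g p))).eventually (h1.and h2)]
    with z hz using ⟨hz.1.le, hz.2.le⟩

theorem eventually_edist_symm_le [Finite ι] {ε : ℝ} (hε : 0 < ε) :
    ∀ᶠ r in 𝓝 (0 : ℝ), ∀ i, ∀ p ∈ W i, ∀ v ∈ closedBall (φ i p) r,
      edist ((φ i).symm v) p ≤ ENNReal.ofReal ε := by
  refine IsCompact.eventually_forall_index H.isCompact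
    (R := fun i r p => ∀ v ∈ closedBall (φ i p) r, edist ((φ i).symm v) p ≤ ENNReal.ofReal ε)
    fun i p hp => ?_
  have h1 : ContinuousAt (fun z : M × E × E => edist ((φ i).symm z.2.1) z.1) (p, φ i p, φ i p) :=
    Filter.Tendsto.edist (ContinuousAt.comp (g := (φ i).symm) (x := (p, φ i p, φ i p))
      (f := fun z : M × E × E => z.2.1) (H.continuousAt_symm hp) (by fun_prop))
      (by fun_prop : ContinuousAt (fun z : M × E × E => z.1) _)
  have h2 : ∀ᶠ z : M × E × E in 𝓝 (p, φ i p, φ i p),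
      edist ((φ i).symm z.2.1) z.1 < ENNReal.ofReal ε :=
    h1.eventually_lt_const (by simpa [H.symm_apply hp] using hε)
  rw [nhds_prod_eq] at h2
  filter_upwards [eventually_forall_mem_closedBall (H.continuousAt_chart hp)
    (H.continuousAt_chart hp) (A := fun p v _ => edist ((φ i).symm v) p < ENNReal.ofReal ε) h2]
    with z hz v hv using (hz v hv v hv).le

theorem eventually_mem_closedBall [Finite ι] [CompactSpace M] {r : ℝ} (hr : 0 < r) :
    ∀ᶠ δ in 𝓝 (0 : ℝ), ∀ i, ∀ p ∈ W i, ∀ p', edist p p' < ENNReal.ofReal δ →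
      p' ∈ (φ i).source ∧ φ i p' ∈ closedBall (φ i p) r := by
  have := IsCompact.eventually_forall_index (Z := fun i => W i ×ˢ (univ : Set M)) (t := 0)
    (R := fun i δ z => edist z.1 z.2 < ENNReal.ofReal δ →
      z.2 ∈ (φ i).source ∧ φ i z.2 ∈ closedBall (φ i z.1) r)
    (fun i => (H.isCompact i).prod isCompact_univ) ?_
  · filter_upwards [this] with δ h i p hp p' using h i (p, p') ⟨hp, mem_univ _⟩
  · rintro i ⟨p, p'⟩ ⟨hp, -⟩
    by_cases hpp : p = p'
    · subst hpp
      have hs : ∀ᶠ z : M × M in 𝓝 (p, p), z.2 ∈ (φ i).source :=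
        (continuous_snd.tendsto (p, p)).eventually
          ((φ i).open_source.mem_nhds (H.subset_source i hp))
      have hc := H.continuousAt_chart hp
      have hd : ContinuousAt (fun z : M × M => dist (φ i z.2) (φ i z.1)) (p, p) :=
        Filter.Tendsto.dist
          (ContinuousAt.comp (g := φ i) (f := fun z : M × M => z.2) (x := (p, p)) hc (by fun_prop))
          (ContinuousAt.comp (g := φ i) (f := fun z : M × M => z.1) (x := (p, p)) hc (by fun_prop))
      have hd' := hd.eventually_lt_const (u := r) (by simpa using hr)
      filter_upwards [(continuous_snd.tendsto ((0 : ℝ), (p, p))).eventually (hs.and hd')]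
        with z hz _ using ⟨hz.1, hz.2.le⟩
    · filter_upwards [eventually_edist_lt_imp (x₀ := (p, p')) (a := fun z : M × M => z.1)
        (b := fun z : M × M => z.2) (by fun_prop) (by fun_prop) hpp] with z hz hz'
      exact absurd hz' hz

end HyperbolicAtlas

end

/-! ### The transform along a pseudo-orbit: expansivity and shadowing for `g` -/

section

variable {M E ι : Type*} [EMetricSpace M] [NormedAddCommGroup E] [NormedSpace ℝ E]
  {g : M ≃ₜ M} {φ : ι → OpenPartialHomeomorph M E} {W : ι → Set M} {P : ι → M → E →L[ℝ] E}

theorem perm_zpow_apply_eq {X : Type*} (g : Equiv.Perm X) {x : ℤ → X}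
    (hx : ∀ n, g (x n) = x (n + 1)) (n : ℤ) : (g ^ n) (x 0) = x n := by
  induction n using Int.induction_on with
  | zero => rfl
  | succ n ih => rw [add_comm, zpow_add, Equiv.Perm.mul_apply, ih, zpow_one, hx, add_comm]
  | pred n ih =>
    have h := hx (-n - 1)
    rw [sub_add_cancel] at h
    rw [sub_eq_neg_add, zpow_add, Equiv.Perm.mul_apply, ih, zpow_neg_one, ← h,
      Equiv.Perm.inv_def, Equiv.symm_apply_apply, sub_eq_neg_add]

/-- The operator on sequences of vectors whose fixed points are the orbits of `g` near the sequence
`y`, read in the charts `φ (k n)`. -/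
def hyperbolicTransform (g : M ≃ₜ M) (φ : ι → OpenPartialHomeomorph M E)
    (P : ι → M → E →L[ℝ] E) (y : ℤ → M) (k : ℤ → ι) (v : ℤ → E) : ℤ → E := fun n =>
  P (k n) (y n) (φ (k n) (g ((φ (k (n - 1))).symm (v (n - 1))))) +
    (1 - P (k n) (y n)) (φ (k n) (g.symm ((φ (k (n + 1))).symm (v (n + 1)))))

/-- The scale `r` is so small that `g` is hyperbolic in the charts on balls of radius `r`. -/
def IsHyperbolicScale (g : M ≃ₜ M) (φ : ι → OpenPartialHomeomorph M E) (W : ι → Set M)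
    (P : ι → M → E →L[ℝ] E) (r : ℝ) : Prop :=
  ∀ i j, ∀ p ∈ W i, ∀ q ∈ W j, edist (g p) q < ENNReal.ofReal r →
    (∀ v ∈ closedBall (φ i p) r, ∀ w ∈ closedBall (φ i p) r,
      ‖P j q (φ j (g ((φ i).symm v)) - φ j (g ((φ i).symm w)))‖ ≤ 1 / 4 * ‖v - w‖) ∧
    (∀ v ∈ closedBall (φ j q) r, ∀ w ∈ closedBall (φ j q) r,
      ‖(1 - P i p) (φ i (g.symm ((φ j).symm v)) - φ i (g.symm ((φ j).symm w)))‖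
        ≤ 1 / 4 * ‖v - w‖) ∧
    (∀ v ∈ closedBall (φ i p) r, ∀ w ∈ closedBall (φ j q) r,
      P j q (w - φ j (g ((φ i).symm v))) = 0 →
      (1 - P i p) (φ i (g.symm ((φ j).symm w)) - v) = 0 →
      g ((φ i).symm v) = (φ j).symm w)

theorem IsHyperbolicScale.dist_hyperbolicTransform_le {r : ℝ} (hr : IsHyperbolicScale g φ W P r)
    {y : ℤ → M} {k : ℤ → ι} (hk : ∀ n, y n ∈ W (k n))
    (hy : ∀ n, edist (g (y n)) (y (n + 1)) < ENNReal.ofReal r) (u v : ℤ → E) (D : ℝ)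
    (hu : ∀ n, u n ∈ closedBall (φ (k n) (y n)) r)
    (hv : ∀ n, v n ∈ closedBall (φ (k n) (y n)) r) (hD : ∀ n, dist (u n) (v n) ≤ D) (n : ℤ) :
    dist (hyperbolicTransform g φ P y k u n) (hyperbolicTransform g φ P y k v n) ≤ D / 2 := by
  have h1 := (hr _ _ _ (hk (n - 1)) _ (hk n) (by simpa using hy (n - 1))).1 _ (hu _) _ (hv _)
  have h2 := (hr _ _ _ (hk n) _ (hk (n + 1)) (hy n)).2.1 _ (hu _) _ (hv _)
  have d1 := hD (n - 1)
  have d2 := hD (n + 1)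
  rw [dist_eq_norm] at d1 d2 ⊢
  rw [hyperbolicTransform, hyperbolicTransform, add_sub_add_comm, ← map_sub, ← map_sub]
  refine (norm_add_le_of_le h1 h2).trans ?_
  linarith

theorem hyperbolicTransform_orbit {y : ℤ → M} {k : ℤ → ι} {x : ℤ → M}
    (hx : ∀ n, x n ∈ (φ (k n)).source) (hgx : ∀ n, g (x n) = x (n + 1)) :
    hyperbolicTransform g φ P y k (fun n => φ (k n) (x n)) = fun n => φ (k n) (x n) := by
  funext n
  have h1 := hgx (n - 1)
  rw [sub_add_cancel] at h1
  rw [hyperbolicTransform, (φ _).left_inv (hx _), (φ _).left_inv (hx _), h1, ← hgx n,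
    g.symm_apply_apply]
  simp

namespace HyperbolicAtlas

variable (H : HyperbolicAtlas g φ W P)
include H

/-- Applying the stable projection to the fixed point equation at `n + 1`, and the unstable one to
the equation at `n`, kills one term of each. What remains are the two hypotheses of the last clause
of `IsHyperbolicScale`. -/
theorem apply_symm_eq_of_fixed {r : ℝ} (hr : IsHyperbolicScale g φ W P r)
    {y : ℤ → M} {k : ℤ → ι} (hk : ∀ n, y n ∈ W (k n))
    (hy : ∀ n, edist (g (y n)) (y (n + 1)) < ENNReal.ofReal r) {v : ℤ → E}
    (hv : ∀ n, v n ∈ closedBall (φ (k n) (y n)) r) (hfix : hyperbolicTransform g φ P y k v = v)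
    (n : ℤ) : g ((φ (k n)).symm (v n)) = (φ (k (n + 1))).symm (v (n + 1)) := by
  have hidem : ∀ n z, P (k n) (y n) (P (k n) (y n) z) = P (k n) (y n) z := fun n z =>
    DFunLike.congr_fun (H.idem _ _ (hk n)) z
  refine (hr _ _ _ (hk n) _ (hk (n + 1)) (hy n)).2.2 _ (hv n) _ (hv (n + 1)) ?_ ?_
  · have e := congr_fun hfix (n + 1)
    rw [hyperbolicTransform, add_sub_cancel_right] at e
    rw [← e]
    simp [hidem]
  · have e := congr_fun hfix n
    rw [hyperbolicTransform] at e
    conv_lhs => rw [← e]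
    simp only [map_sub, map_add, sub_apply, one_apply_eq_self, hidem]
    abel

/-- In charts chosen along the orbit of `x`, both orbits are fixed points of the same transform in
the same balls. -/
theorem exists_isExpansivityConstant [Finite ι] [CompactSpace M] :
    ∃ ρ : ℝ, IsExpansivityConstant g.toEquiv ρ := by
  obtain ⟨r, hr0, hr⟩ := exists_pos_of_eventually_nhds_zero H.eventually_hyperbolic
  change IsHyperbolicScale g φ W P r at hr
  obtain ⟨δ, hδ0, hδ⟩ := exists_pos_of_eventually_nhds_zero (H.eventually_mem_closedBall hr0)
  -- Halving turns the non-strict bound of expansivity into the strict one required by `hδ`.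
  refine ⟨δ / 2, half_pos hδ0, fun x y => ⟨fun hxy => ?_, ?_⟩⟩
  swap
  · rintro rfl n
    simp
  choose k hk using fun n : ℤ => H.cover ((g.toEquiv ^ n) x)
  have horb : ∀ (x : M) (n : ℤ), g ((g.toEquiv ^ n) x) = (g.toEquiv ^ (n + 1)) x := by
    intro x n
    rw [add_comm, zpow_add, zpow_one]
    rfl
  have hclose : ∀ n, (g.toEquiv ^ n) y ∈ (φ (k n)).source ∧
      φ (k n) ((g.toEquiv ^ n) y) ∈ closedBall (φ (k n) ((g.toEquiv ^ n) x)) r := fun n =>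
    hδ _ _ (hk n) _ ((hxy n).trans_lt
      ((ENNReal.ofReal_lt_ofReal_iff hδ0).2 (half_lt_self hδ0)))
  have hps : ∀ n : ℤ, edist (g ((g.toEquiv ^ n) x)) ((g.toEquiv ^ (n + 1)) x) < ENNReal.ofReal r := by
    intro n
    rw [horb, edist_self]
    exact ENNReal.ofReal_pos.2 hr0
  have heq := fixed_unique_of_contracting
    (hr.dist_hyperbolicTransform_le (y := fun n => (g.toEquiv ^ n) x) hk hps)
    (u := fun n => φ (k n) ((g.toEquiv ^ n) x)) (v := fun n => φ (k n) ((g.toEquiv ^ n) y))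
    (fun n => mem_closedBall_self hr0.le) (fun n => (hclose n).2)
    (hyperbolicTransform_orbit (fun n => H.subset_source _ (hk n)) (horb x))
    (hyperbolicTransform_orbit (fun n => (hclose n).1) (horb y))
  exact (φ (k 0)).injOn (H.subset_source _ (hk 0)) (hclose 0).1 (congr_fun heq 0)

theorem exists_pseudoOrbitsShadowed [Finite ι] [CompleteSpace E] {β : ℝ} (hβ : 0 < β) :
    ∃ α : ℝ, 0 < α ∧ PseudoOrbitsShadowed g.toEquiv α β := by
  obtain ⟨r, hr0, hr, hrβ⟩ := exists_pos_of_eventually_nhds_zero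
    (H.eventually_hyperbolic.and (H.eventually_edist_symm_le hβ))
  change IsHyperbolicScale g φ W P r at hr
  -- The stable and the unstable defect, each at most `r / 4`, add up to the `r / 2` allowed by the
  -- fixed point theorem.
  obtain ⟨δ, hδ0, hδ, hδr⟩ := exists_pos_of_eventually_nhds_zero
    ((H.eventually_defect (ε := r / 4) (by positivity)).and (gt_mem_nhds hr0))
  refine ⟨δ, hδ0, fun y hy => ?_⟩
  choose k hk using fun n : ℤ => H.cover (y n)
  have hps : ∀ n, edist (g (y n)) (y (n + 1)) < ENNReal.ofReal r := fun n =>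
    (hy n).trans_le (ENNReal.ofReal_le_ofReal hδr.le)
  obtain ⟨v, hv, hfix⟩ := exists_fixed_of_contracting (c := fun n => φ (k n) (y n))
    (hr.dist_hyperbolicTransform_le hk hps) hr0.le fun n => by
      have h1 := (hδ _ _ _ (hk (n - 1)) _ (hk n) (by simpa using hy (n - 1))).1
      have h2 := (hδ _ _ _ (hk n) _ (hk (n + 1)) (hy n)).2
      rw [dist_eq_norm, hyperbolicTransform, H.symm_apply (hk _), H.symm_apply (hk _)]
      have e : P (k n) (y n) (φ (k n) (g (y (n - 1)))) +
          (1 - P (k n) (y n)) (φ (k n) (g.symm (y (n + 1)))) - φ (k n) (y n) =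
          P (k n) (y n) (φ (k n) (g (y (n - 1))) - φ (k n) (y n)) +
          (1 - P (k n) (y n)) (φ (k n) (g.symm (y (n + 1))) - φ (k n) (y n)) := by
        simp only [map_sub, sub_apply, one_apply_eq_self]
        abel
      rw [e]
      refine (norm_add_le_of_le h1 h2).trans ?_
      linarith
  have horb := H.apply_symm_eq_of_fixed hr hk hps hv hfix
  refine ⟨(φ (k 0)).symm (v 0), fun n => ?_⟩
  rw [fullOrbit, perm_zpow_apply_eq g.toEquiv (x := fun n => (φ (k n)).symm (v n)) horb, edist_comm]
  exact hrβ _ _ (hk n) _ (hv n)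

end HyperbolicAtlas

end

/-! ### Passing from an iterate of `f` to `f` -/

section

variable {M : Type*} [EMetricSpace M]

theorem IsExpansivityConstant.of_zpow {f : Equiv.Perm M} {N : ℤ} {ρ : ℝ}
    (h : IsExpansivityConstant (f ^ N) ρ) : IsExpansivityConstant f ρ := by
  refine ⟨h.1, fun x y => ⟨fun hxy => (h.2 x y).1 fun n => ?_, ?_⟩⟩
  · rw [← zpow_mul]
    exact hxy _
  · rintro rfl n
    simp

theorem UniformContinuous.exists_ofReal_edist {f : M → M} (hf : UniformContinuous f) {ε : ℝ}
    (hε : 0 < ε) : ∃ δ : ℝ, 0 < δ ∧ ∀ x y : M, edist x y < ENNReal.ofReal δ →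
      edist (f x) (f y) < ENNReal.ofReal ε := by
  obtain ⟨δ, hδ, h⟩ := EMetric.uniformContinuous_iff.1 hf _ (ENNReal.ofReal_pos.2 hε)
  obtain ⟨a, ha, haδ⟩ := ENNReal.lt_iff_exists_nnreal_btwn.1 hδ
  refine ⟨a, by exact_mod_cast ha, fun x y hxy => h ?_⟩
  rw [ENNReal.ofReal_coe_nnreal] at hxy
  exact hxy.trans haδ

theorem exists_forall_pseudoOrbit_iterate_lt {f : M → M} (hf : UniformContinuous f) (j : ℕ) {ε : ℝ}
    (hε : 0 < ε) : ∃ δ : ℝ, 0 < δ ∧ ∀ y : ℤ → M, IsPseudoOrbit f δ y →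
      ∀ n, edist (f^[j] (y n)) (y (n + j)) < ENNReal.ofReal ε := by
  induction j generalizing ε with
  | zero => exact ⟨1, one_pos, fun y _ n => by simpa using hε⟩
  | succ j ih =>
    obtain ⟨η, hη, hfη⟩ := hf.exists_ofReal_edist (half_pos hε)
    obtain ⟨δ, hδ, h⟩ := ih hη
    refine ⟨min δ (ε / 2), lt_min hδ (half_pos hε), fun y hy n => ?_⟩
    have h1 := h y (fun n => (hy n).trans_le (ENNReal.ofReal_le_ofReal (min_le_left _ _))) n
    have h2 := (hy (n + j)).trans_le (ENNReal.ofReal_le_ofReal (min_le_right _ _))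
    have h3 := hfη _ _ h1
    rw [Function.iterate_succ_apply']
    have e : n + ((j + 1 : ℕ) : ℤ) = n + j + 1 := by push_cast; ring
    rw [e]
    calc _ ≤ _ := edist_triangle _ (f (y (n + j))) _
      _ < ENNReal.ofReal (ε / 2) + ENNReal.ofReal (ε / 2) := ENNReal.add_lt_add h3 h2
      _ = ENNReal.ofReal ε := by
        rw [← ENNReal.ofReal_add (half_pos hε).le (half_pos hε).le, add_halves]

theorem exists_forall_lt_of_forall_exists {p : ℕ → ℝ → Prop}
    (hp : ∀ j δ δ', 0 < δ' → δ' ≤ δ → p j δ → p j δ') (h : ∀ j, ∃ δ > 0, p j δ) (N : ℕ) :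
    ∃ δ > 0, ∀ j < N, p j δ := by
  induction N with
  | zero => exact ⟨1, one_pos, fun j hj => absurd hj (Nat.not_lt_zero j)⟩
  | succ N ih =>
    obtain ⟨δ, hδ, h1⟩ := ih
    obtain ⟨δ', hδ', h2⟩ := h N
    refine ⟨min δ δ', lt_min hδ hδ', fun j hj => ?_⟩
    rcases Nat.lt_succ_iff_lt_or_eq.1 hj with hj | rfl
    · exact hp _ _ _ (lt_min hδ hδ') (min_le_left _ _) (h1 j hj)
    · exact hp _ _ _ (lt_min hδ hδ') (min_le_right _ _) h2

/-- Every `N`-th term of a pseudo-orbit of `f` forms a pseudo-orbit of `f ^ N`, shadowed by the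
orbit of some `x`. At `n = N * (n / N) + j`, both the orbit and `y n` are within `β / 2` of `f^[j]
(y (N * (n / N)))`. -/
theorem exists_pseudoOrbitsShadowed_of_pow {f : Equiv.Perm M} (hf : UniformContinuous f)
    {N : ℕ} (hN : 0 < N)
    (h : ∀ β : ℝ, 0 < β → ∃ α : ℝ, 0 < α ∧ PseudoOrbitsShadowed (f ^ N) α β) {β : ℝ} (hβ : 0 < β) :
    ∃ α : ℝ, 0 < α ∧ PseudoOrbitsShadowed f α β := by
  have hβ2 := half_pos hβ
  obtain ⟨β₁, hβ₁, hb⟩ := exists_forall_lt_of_forall_exists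
    (p := fun j δ => ∀ x y : M, edist x y < ENNReal.ofReal δ →
      edist (f^[j] x) (f^[j] y) < ENNReal.ofReal (β / 2))
    (fun j δ δ' _ hle H x y hxy => H x y (hxy.trans_le (ENNReal.ofReal_le_ofReal hle)))
    (fun j => (UniformContinuous.iterate f j hf).exists_ofReal_edist hβ2) N
  obtain ⟨α₁, hα₁, hs⟩ := h (β₁ / 2) (half_pos hβ₁)
  have hε : 0 < min α₁ (β / 2) := lt_min hα₁ hβ2
  -- The range `N + 1` includes `j = N`, which makes the subsequence a pseudo-orbit of `f ^ N`; the
  -- values `j < N` serve the interpolation.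
  obtain ⟨δ, hδ, hd⟩ := exists_forall_lt_of_forall_exists
    (p := fun j δ => ∀ y : ℤ → M, IsPseudoOrbit f δ y →
      ∀ n, edist (f^[j] (y n)) (y (n + j)) < ENNReal.ofReal (min α₁ (β / 2)))
    (fun j δ δ' _ hle H y hy => H y fun n => (hy n).trans_le (ENNReal.ofReal_le_ofReal hle))
    (fun j => exists_forall_pseudoOrbit_iterate_lt hf j hε) (N + 1)
  refine ⟨δ, hδ, fun y hy => ?_⟩
  obtain ⟨x, hx⟩ := hs (fun k => y (N * k)) fun k => by
    have := (hd N (Nat.lt_succ_self N) y hy (N * k)).trans_le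
      (ENNReal.ofReal_le_ofReal (min_le_left _ _))
    rw [Equiv.Perm.iterate_eq_pow] at this
    simpa only [mul_add, mul_one] using this
  refine ⟨x, fun n => ?_⟩
  have hNz : (0 : ℤ) < N := by exact_mod_cast hN
  obtain ⟨j, hj⟩ := Int.eq_ofNat_of_zero_le (Int.emod_nonneg n hNz.ne')
  have hjN : j < N := by
    have := Int.emod_lt_of_pos n hNz
    omega
  have hn : n = N * (n / N) + j := by rw [← hj]; exact (Int.mul_ediv_add_emod n N).symm
  have h1 := hx (n / N)
  rw [fullOrbit, ← zpow_natCast f N, ← zpow_mul, edist_comm] at h1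
  have h2 := hb j hjN _ _ (h1.trans_lt
    ((ENNReal.ofReal_lt_ofReal_iff hβ₁).2 (half_lt_self hβ₁)))
  have h3 := (hd j (hjN.trans (Nat.lt_succ_self N)) y hy (N * (n / N))).trans_le
    (ENNReal.ofReal_le_ofReal (min_le_right _ _))
  rw [← hn] at h3
  have e : (f ^ n) x = f^[j] ((f ^ ((N : ℤ) * (n / N))) x) := by
    rw [Equiv.Perm.iterate_eq_pow, ← zpow_natCast f j, ← Equiv.Perm.mul_apply, ← zpow_add,
      add_comm (j : ℤ), ← hn]
  rw [fullOrbit, e, edist_comm]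
  calc _ ≤ _ := edist_triangle _ (f^[j] (y (N * (n / N)))) _
    _ ≤ ENNReal.ofReal (β / 2) + ENNReal.ofReal (β / 2) := add_le_add h2.le h3.le
    _ = ENNReal.ofReal β := by rw [← ENNReal.ofReal_add hβ2.le hβ2.le, add_halves]

/-! ### The symbolic model -/

theorem Homeomorph.continuous_toEquiv_zpow {X : Type*} [TopologicalSpace X] (f : X ≃ₜ X) (n : ℤ) :
    Continuous ⇑(f.toEquiv ^ n) := by
  induction n using Int.induction_on with
  | zero => exact continuous_id
  | succ n ih =>
    rw [zpow_add, zpow_one]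
    exact ih.comp f.continuous
  | pred n ih =>
    rw [sub_eq_add_neg, zpow_add, zpow_neg_one]
    exact ih.comp f.symm.continuous

/-- The preimage of a closed set is the projection of a closed part of the graph, and projection
along a compact factor is closed. -/
theorem continuous_of_isClosed_graph {X Y : Type*} [TopologicalSpace X] [TopologicalSpace Y]
    [CompactSpace Y] {θ : X → Y} (h : IsClosed {z : X × Y | z.2 = θ z.1}) : Continuous θ := by
  refine continuous_iff_isClosed.2 fun C hC => ?_
  have e : θ ⁻¹' C = Prod.fst '' ({z : X × Y | z.2 = θ z.1} ∩ Prod.snd ⁻¹' C) := by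
    ext x
    constructor
    · intro hx
      exact ⟨(x, θ x), ⟨rfl, hx⟩, rfl⟩
    · rintro ⟨⟨x, y⟩, ⟨hy, hyC⟩, rfl⟩
      simp only [mem_ofPred_eq, mem_preimage] at hy hyC ⊢
      exact hy ▸ hyC
  rw [e]
  exact isClosedMap_fst_of_compactSpace _ (h.inter (hC.preimage continuous_snd))

theorem IsExpansivityConstant.shadows_unique {f : Equiv.Perm M} {ρ β : ℝ}
    (hρ : IsExpansivityConstant f ρ) (hβ : 0 < β) (hβρ : β < ρ / 2) {y : ℤ → M} {x x' : M}
    (hx : Shadows β (fullOrbit f x) y) (hx' : Shadows β (fullOrbit f x') y) : x = x' := by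
  refine (hρ.2 x x').1 fun n => ?_
  have h1 := hx n
  have h2 := hx' n
  rw [edist_comm] at h1
  calc _ ≤ _ := edist_triangle _ (y n) _
    _ ≤ ENNReal.ofReal β + ENNReal.ofReal β := add_le_add h1 h2
    _ = ENNReal.ofReal (β + β) := (ENNReal.ofReal_add hβ.le hβ.le).symm
    _ ≤ ENNReal.ofReal ρ := ENNReal.ofReal_le_ofReal (by linarith)

theorem exists_isGammaDense [CompactSpace M] {γ : ℝ} (hγ : 0 < γ) :
    ∃ P : Finset M, IsGammaDense P γ := by
  obtain ⟨t, ht⟩ := isCompact_univ.elim_nhds_subcover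
    (fun x : M => {y | edist y x < ENNReal.ofReal γ})
    (fun x _ => Metric.eball_mem_nhds x (ENNReal.ofReal_pos.2 hγ))
  refine ⟨t, fun x => ?_⟩
  obtain ⟨p, hp, hxp⟩ := mem_iUnion₂.1 (ht.2 (mem_univ x))
  exact ⟨p, hp, hxp⟩

theorem isSemiconjugacy_of_shadows [CompactSpace M] (f : M ≃ₜ M) {ρ α β γ : ℝ} {P : Finset M}
    (hρ : IsExpansivityConstant f.toEquiv ρ) (hβ : 0 < β) (hβρ : β < ρ / 2)
    (hγβ : γ < min β (α / 2)) (hα : 0 < α)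
    (hfγ : ∀ x y : M, edist x y < ENNReal.ofReal γ → edist (f x) (f y) < ENNReal.ofReal (α / 2))
    (hP : IsGammaDense P γ) {θ : pseudoOrbitSpace f α P → M}
    (hθ : ∀ q : pseudoOrbitSpace f α P,
      Shadows β (fullOrbit f.toEquiv (θ q)) (fun n => (q.1 n : M))) :
    IsSemiconjugacy f (shiftOn f α P) θ := by
  have huniq : ∀ (q : pseudoOrbitSpace f α P) (x : M),
      Shadows β (fullOrbit f.toEquiv x) (fun n => (q.1 n : M)) → x = θ q := fun q x hx =>
    hρ.shadows_unique hβ hβρ hx (hθ q)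
  refine ⟨?_, fun x => ?_, ?_⟩
  · refine continuous_of_isClosed_graph ?_
    -- By uniqueness, the shadowing inequalities characterise the graph, and each of them is a
    -- closed condition.
    have : {z : pseudoOrbitSpace f α P × M | z.2 = θ z.1} = ⋂ n : ℤ,
        {z | edist (z.1.1 n : M) ((f.toEquiv ^ n) z.2) ≤ ENNReal.ofReal β} := by
      ext ⟨q, x⟩
      simp only [mem_ofPred_eq, mem_iInter]
      exact ⟨fun h => h ▸ hθ q, huniq q x⟩
    rw [this]
    refine isClosed_iInter fun n => isClosed_le ?_ continuous_const
    exact (continuous_subtype_val.comp ((continuous_apply n).comp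
      (continuous_subtype_val.comp continuous_fst))).edist
      ((f.continuous_toEquiv_zpow n).comp continuous_snd)
  -- Each orbit point is rounded to a point of `P`. One half of `α` covers the image under `f` of
  -- the rounding error at `n`, the other half the error at `n + 1`.
  · choose q hq hqx using fun n : ℤ => hP ((f.toEquiv ^ n) x)
    have hqmem : (fun n => (⟨q n, hq n⟩ : P)) ∈ pseudoOrbitSpace f α P := fun n => by
      have h1 := hfγ _ _ (by rw [edist_comm]; exact hqx n)
      have h2 := (hqx (n + 1)).trans_le
        (ENNReal.ofReal_le_ofReal (hγβ.le.trans (min_le_right _ _)))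
      have e : f ((f.toEquiv ^ n) x) = (f.toEquiv ^ (n + 1)) x := by
        rw [add_comm, zpow_add, zpow_one]
        rfl
      calc _ ≤ _ := edist_triangle _ (f ((f.toEquiv ^ n) x)) _
        _ < ENNReal.ofReal (α / 2) + ENNReal.ofReal (α / 2) :=
          ENNReal.add_lt_add h1 (e ▸ h2)
        _ = ENNReal.ofReal α := by
          rw [← ENNReal.ofReal_add (half_pos hα).le (half_pos hα).le, add_halves]
    refine ⟨⟨_, hqmem⟩, (huniq _ x fun n => ?_).symm⟩
    rw [edist_comm]
    exact (hqx n).le.trans (ENNReal.ofReal_le_ofReal (hγβ.le.trans (min_le_left _ _)))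
  · funext q
    refine huniq (shiftOn f α P q) _ fun n => ?_
    have h := hθ q (n + 1)
    have e : fullOrbit f.toEquiv (f (θ q)) n = fullOrbit f.toEquiv (θ q) (n + 1) := by
      rw [fullOrbit, fullOrbit, zpow_add, zpow_one]
      rfl
    exact e ▸ h

end

/-! ### Continuity of projections -/

/-- Let `A` be the map whose columns are both frames, and `C` the same with the second frame
replaced by zero. Then `P ∘ A = C`, hence `P = C ∘ A⁻¹`, and inversion is continuous at invertible
maps. -/
theorem continuousAt_projection_of_frames {X E : Type*} [TopologicalSpace X]
    [NormedAddCommGroup E] [NormedSpace ℝ E] [FiniteDimensional ℝ E] {m n : ℕ}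
    {s : Fin m → X → E} {u : Fin n → X → E} {P : X → E →L[ℝ] E} {x₀ : X}
    (hs : ∀ i, ContinuousAt (s i) x₀) (hu : ∀ i, ContinuousAt (u i) x₀)
    (h : ∀ᶠ x in 𝓝 x₀, LinearIndependent ℝ (fun i => s i x) ∧
      LinearIndependent ℝ (fun i => u i x) ∧
      IsCompl (Submodule.span ℝ (range fun i => s i x)) (Submodule.span ℝ (range fun i => u i x)) ∧
      (∀ i, P x (s i x) = s i x) ∧ ∀ i, P x (u i x) = 0) : ContinuousAt P x₀ := by
  let V := Fin m ⊕ Fin n → ℝ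
  let pr : Fin m ⊕ Fin n → V →L[ℝ] ℝ := fun i => ContinuousLinearMap.proj i
  let C : X → V →L[ℝ] E := fun x => ∑ i, (pr (Sum.inl i)).smulRight (s i x)
  let A : X → V →L[ℝ] E := fun x => C x + ∑ i, (pr (Sum.inr i)).smulRight (u i x)
  have hsmul : ∀ (c : V →L[ℝ] ℝ) {w : X → E}, ContinuousAt w x₀ →
      ContinuousAt (fun x => c.smulRight (w x)) x₀ := fun c w hw =>
    (ContinuousLinearMap.smulRightL ℝ V E c).continuous.continuousAt.comp hw
  have hC : ContinuousAt C x₀ := tendsto_finsetSum _ fun i _ => hsmul _ (hs i)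
  have hA : ContinuousAt A x₀ :=
    Filter.Tendsto.add hC (tendsto_finsetSum _ fun i _ => hsmul _ (hu i))
  have key : ∀ᶠ x in 𝓝 x₀, ∃ e : V ≃L[ℝ] E, (e : V →L[ℝ] E) = A x ∧ P x ∘L A x = C x := by
    filter_upwards [h] with x ⟨h1, h2, h3, h4, h5⟩
    have hli : LinearIndependent ℝ (Sum.elim (fun i => s i x) fun i => u i x) :=
      h1.sum_type h2 h3.disjoint
    have hsp : ⊤ ≤ Submodule.span ℝ (range (Sum.elim (fun i => s i x) fun i => u i x)) := by
      rw [Sum.elim_range, Submodule.span_union, h3.sup_eq_top]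
    let b := Module.Basis.mk hli hsp
    refine ⟨b.equivFunL.symm, ?_, ?_⟩
    · ext c
      have : b.equivFun.symm c = A x c := by
        rw [Module.Basis.equivFun_symm_apply]
        simp [b, A, C, pr]
        rfl
      exact this
    · ext c
      simp [A, C, pr, h4, h5]
  obtain ⟨e, he, -⟩ := key.self_of_nhds
  have hinv : ContinuousAt (fun x => (A x).inverse) x₀ := by
    have h1 : ContinuousAt ContinuousLinearMap.inverse (A x₀) := by
      rw [← he]
      exact (contDiffAt_map_inverse (n := 0) e).continuousAt
    exact ContinuousAt.comp (g := ContinuousLinearMap.inverse) h1 hA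
  refine (ContinuousAt.clm_comp hC hinv).congr ?_
  filter_upwards [key] with x ⟨e, he, hx⟩
  rw [← hx, ← he, ContinuousLinearMap.inverse_equiv, ContinuousLinearMap.comp_assoc]
  ext z
  simp

/-! ### Splittings of the tangent bundle read in charts -/

section

variable {E : Type*} [NormedAddCommGroup E] [NormedSpace ℝ E]
  {M : Type*} [EMetricSpace M] [ChartedSpace E M] [IsManifold 𝓘(ℝ, E) 1 M]

variable (E) in
/-- The derivative at `x` of the chart at `a`. -/
noncomputable def chartDeriv (a x : M) : TangentSpace 𝓘(ℝ, E) x →L[ℝ] E :=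
  (trivializationAt E (TangentSpace 𝓘(ℝ, E)) a).continuousLinearMapAt ℝ x

variable (E) in
/-- The derivative of the inverse of the chart at `a`, with values in the tangent space at `x`. -/
noncomputable def chartDerivSymm (a x : M) : E →L[ℝ] TangentSpace 𝓘(ℝ, E) x :=
  (trivializationAt E (TangentSpace 𝓘(ℝ, E)) a).symmL ℝ x

theorem chartDerivSymm_chartDeriv {a x : M} (hx : x ∈ (chartAt E a).source)
    (v : TangentSpace 𝓘(ℝ, E) x) : chartDerivSymm E a x (chartDeriv E a x v) = v :=
  Trivialization.symmL_continuousLinearMapAt _ (by simpa using hx) v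

theorem chartDeriv_chartDerivSymm {a x : M} (hx : x ∈ (chartAt E a).source) (v : E) :
    chartDeriv E a x (chartDerivSymm E a x v) = v :=
  Trivialization.continuousLinearMapAt_symmL _ (by simpa using hx) v

/-- A `C¹` map is strictly differentiable in charts. The chain rule for `chartAt E b ∘ h`, which
near `p` is the chart expression composed with `chartAt E a`, identifies the derivative. -/
theorem hasStrictFDerivAt_in_charts {h : M → M} (hh : ContMDiff 𝓘(ℝ, E) 𝓘(ℝ, E) 1 h) {a b p : M}
    (ha : p ∈ (chartAt E a).source) (hb : h p ∈ (chartAt E b).source) :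
    HasStrictFDerivAt (chartAt E b ∘ h ∘ (chartAt E a).symm)
      (chartDeriv E b (h p) ∘L mfderiv 𝓘(ℝ, E) 𝓘(ℝ, E) h p ∘L chartDerivSymm E a p)
      (chartAt E a p) := by
  have h1 := ((contMDiffAt_iff_of_mem_source ha hb).1 (hh p)).2
  simp only [modelWithCornersSelf_coe, range_id, contDiffWithinAt_univ] at h1
  replace h1 : ContDiffAt ℝ 1 (chartAt E b ∘ h ∘ (chartAt E a).symm) (chartAt E a p) := h1
  have h2 := h1.hasStrictFDerivAt one_ne_zero
  have hext : ∀ c : M, ⇑(extChartAt 𝓘(ℝ, E) c) = chartAt E c := fun c => rfl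
  have dφ : ∀ {c q : M}, q ∈ (chartAt E c).source →
      HasMFDerivAt 𝓘(ℝ, E) 𝓘(ℝ, E) (chartAt E c) q (chartDeriv E c q) := fun {c q} hq => by
    have := (mdifferentiableAt_extChartAt (I := 𝓘(ℝ, E)) hq).hasMFDerivAt
    rwa [← TangentBundle.continuousLinearMapAt_trivializationAt hq] at this
  have d1 := HasMFDerivAt.comp p h2.hasFDerivAt.hasMFDerivAt (dφ ha)
  have d2 := HasMFDerivAt.comp p (dφ hb) ((hh p).mdifferentiableAt one_ne_zero).hasMFDerivAt
  have hev : (chartAt E b ∘ h ∘ (chartAt E a).symm) ∘ chartAt E a =ᶠ[𝓝 p] chartAt E b ∘ h := by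
    filter_upwards [(chartAt E a).open_source.mem_nhds ha] with x hx
    simp [(chartAt E a).left_inv hx]
  have d3 := hasMFDerivAt_unique d1 (d2.congr_of_eventuallyEq hev)
  convert h2 using 1
  ext v
  have := DFunLike.congr_fun d3 (chartDerivSymm E a p v)
  refine this.symm.trans ?_
  exact congrArg _ (chartDeriv_chartDerivSymm ha v)

/-- The projection onto `S` along `U`, read in the chart at `a`. -/
noncomputable def chartProj [FiniteDimensional ℝ E]
    {S U : ∀ x : M, Submodule ℝ (TangentSpace 𝓘(ℝ, E) x)} (hSU : ∀ x, IsCompl (S x) (U x))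
    (a x : M) : E →L[ℝ] E :=
  LinearMap.toContinuousLinearMap
    ((chartDeriv E a x).toLinearMap ∘ₗ (S x).projection (U x) (hSU x) ∘ₗ (chartDerivSymm E a x).toLinearMap)

section chartProj

variable [FiniteDimensional ℝ E] {S U : ∀ x : M, Submodule ℝ (TangentSpace 𝓘(ℝ, E) x)}
  (hSU : ∀ x, IsCompl (S x) (U x))

theorem chartProj_apply (a x : M) (v : E) :
    chartProj hSU a x v = chartDeriv E a x ((S x).projection (U x) (hSU x) (chartDerivSymm E a x v)) :=
  rfl

theorem chartDerivSymm_chartProj {a x : M} (hx : x ∈ (chartAt E a).source) (v : E) :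
    chartDerivSymm E a x (chartProj hSU a x v) = (S x).projection (U x) (hSU x) (chartDerivSymm E a x v) := by
  rw [chartProj_apply, chartDerivSymm_chartDeriv hx]

theorem chartProj_chartDeriv {a x : M} (hx : x ∈ (chartAt E a).source)
    (v : TangentSpace 𝓘(ℝ, E) x) :
    chartProj hSU a x (chartDeriv E a x v) = chartDeriv E a x ((S x).projection (U x) (hSU x) v) := by
  rw [chartProj_apply, chartDerivSymm_chartDeriv hx]

/-- Exchanging the two fields yields the complementary projection, so unstable estimates follow from
stable ones. -/
theorem chartProj_symm {a x : M} (hx : x ∈ (chartAt E a).source) :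
    chartProj (fun x => (hSU x).symm) a x = 1 - chartProj hSU a x := by
  ext v
  rw [chartProj_apply, Submodule.projection_eq_id_sub_projection (hSU x)]
  simp only [LinearMap.sub_apply, LinearMap.id_apply, map_sub, chartDeriv_chartDerivSymm hx]
  rfl

theorem chartProj_comp_self {a x : M} (hx : x ∈ (chartAt E a).source) :
    chartProj hSU a x ∘L chartProj hSU a x = chartProj hSU a x := by
  ext v
  rw [ContinuousLinearMap.comp_apply, chartProj_apply, chartDerivSymm_chartProj hSU hx,
    chartProj_apply]
  congr 1
  exact DFunLike.congr_fun (Submodule.isIdempotentElem_projection (hSU x)) _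

theorem continuousAt_chartProj (hS : IsContinuousDistribution S) (hU : IsContinuousDistribution U)
    {a x₀ : M} (hx₀ : x₀ ∈ (chartAt E a).source) : ContinuousAt (chartProj hSU a) x₀ := by
  obtain ⟨W, hW, m, X, hX, hXS⟩ := hS x₀
  obtain ⟨W', hW', n, Y, hY, hYU⟩ := hU x₀
  have hsrc : (chartAt E a).source ∈ 𝓝 x₀ := (chartAt E a).open_source.mem_nhds hx₀
  have hcont : ∀ {W : Set M} {Z : ∀ x : M, TangentSpace 𝓘(ℝ, E) x}, W ∈ 𝓝 x₀ →
      ContinuousOn (fun x => (⟨x, Z x⟩ : TangentBundle 𝓘(ℝ, E) M)) W →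
      ContinuousAt (fun x => chartDeriv E a x (Z x)) x₀ := by
    intro W Z hW hZ
    let e := trivializationAt E (TangentSpace 𝓘(ℝ, E) : M → Type _) a
    have h1 : ContinuousAt e (⟨x₀, Z x₀⟩ : TangentBundle 𝓘(ℝ, E) M) :=
      e.continuousAt (by rw [e.mem_source]; simpa [e] using hx₀)
    have h2 := ContinuousAt.comp (g := e)
      (f := fun x => (⟨x, Z x⟩ : TangentBundle 𝓘(ℝ, E) M)) h1 (hZ.continuousAt hW)
    refine (continuous_snd.continuousAt.comp h2).congr ?_
    filter_upwards [hsrc] with x hx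
    rw [chartDeriv, Trivialization.continuousLinearMapAt_apply_of_mem]
    · rfl
    · simpa using hx
  refine continuousAt_projection_of_frames (s := fun i x => chartDeriv E a x (X i x))
    (u := fun i x => chartDeriv E a x (Y i x)) (fun i => hcont hW (hX i))
    (fun i => hcont hW' (hY i)) ?_
  filter_upwards [hW, hW', hsrc] with x hxW hxW' hx
  obtain ⟨hXl, hXs⟩ := hXS x hxW
  obtain ⟨hYl, hYs⟩ := hYU x hxW'
  let L : TangentSpace 𝓘(ℝ, E) x ≃ₗ[ℝ] E :=
    { (chartDeriv E a x).toLinearMap with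
      invFun := chartDerivSymm E a x
      left_inv := chartDerivSymm_chartDeriv hx
      right_inv := chartDeriv_chartDerivSymm hx }
  have hspan : ∀ {k : ℕ} (Z : Fin k → TangentSpace 𝓘(ℝ, E) x),
      Submodule.span ℝ (range fun i => chartDeriv E a x (Z i))
        = (Submodule.span ℝ (range Z)).map L.toLinearMap := by
    intro k Z
    rw [Submodule.map_span, ← range_comp]
    rfl
  refine ⟨hXl.map' L.toLinearMap L.ker, hYl.map' L.toLinearMap L.ker, ?_, fun i => ?_, fun i => ?_⟩
  · rw [hspan, hspan, hXs, hYs]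
    exact (hSU x).map (Submodule.orderIsoMapComap L)
  · rw [chartProj_chartDeriv hSU hx, Submodule.projection_apply_of_mem_left]
    exact hXs ▸ Submodule.subset_span (mem_range_self i)
  · rw [chartProj_chartDeriv hSU hx, (Submodule.projection_apply_eq_zero_iff _).2, map_zero]
    exact hYs ▸ Submodule.subset_span (mem_range_self i)

end chartProj

end

/-! ### Invariant fields and norm control in charts -/

section

variable {E : Type*} [NormedAddCommGroup E] [NormedSpace ℝ E]
  {M : Type*} [EMetricSpace M] [ChartedSpace E M] [IsManifold 𝓘(ℝ, E) 1 M]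

/-- The derivative of `h` maps the field of subspaces `S` into itself. -/
def PreservesField (h : M → M) (S : ∀ x : M, Submodule ℝ (TangentSpace 𝓘(ℝ, E) x)) : Prop :=
  ∀ x, ∀ s ∈ S x, mfderiv 𝓘(ℝ, E) 𝓘(ℝ, E) h x s ∈ S (h x)

section

variable {S : ∀ x : M, Submodule ℝ (TangentSpace 𝓘(ℝ, E) x)}

omit [IsManifold 𝓘(ℝ, E) 1 M] in
theorem PreservesField.id : PreservesField (id : M → M) S := fun x s hs => by
  rw [mfderiv_id]
  exact hs

omit [IsManifold 𝓘(ℝ, E) 1 M] in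
theorem PreservesField.comp {h k : M → M} (hh : PreservesField h S) (hk : PreservesField k S)
    (dh : MDifferentiable 𝓘(ℝ, E) 𝓘(ℝ, E) h) (dk : MDifferentiable 𝓘(ℝ, E) 𝓘(ℝ, E) k) :
    PreservesField (h ∘ k) S := fun x s hs => by
  rw [mfderiv_comp x (dh _) (dk _)]
  exact hh _ _ (hk x s hs)

omit [IsManifold 𝓘(ℝ, E) 1 M] in
theorem PreservesField.of_leftInverse {h k : M → M}
    (hS : ∀ x, (S x).map (mfderiv 𝓘(ℝ, E) 𝓘(ℝ, E) h x).toLinearMap = S (h x))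
    (dh : MDifferentiable 𝓘(ℝ, E) 𝓘(ℝ, E) h) (dk : MDifferentiable 𝓘(ℝ, E) 𝓘(ℝ, E) k)
    (hkh : Function.LeftInverse k h) (hsurj : Function.Surjective h) : PreservesField k S := by
  intro x s hs
  obtain ⟨y, rfl⟩ := hsurj x
  rw [← hS y] at hs
  obtain ⟨s', hs', rfl⟩ := hs
  -- The map `l` is kept general because the tangent space at `l y` depends on it; substituting `l =
  -- id` handles all occurrences at once.
  have hid : ∀ l : M → M, l = _root_.id → ∀ s ∈ S y, mfderiv 𝓘(ℝ, E) 𝓘(ℝ, E) l y s ∈ S (l y) := by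
    rintro l rfl s hs
    exact PreservesField.id y s hs
  have := hid (k ∘ h) (funext hkh) s' hs'
  rw [mfderiv_comp y (dk _) (dh _)] at this
  exact this

omit [IsManifold 𝓘(ℝ, E) 1 M] in
theorem Diffeomorph.contMDiff_zpow (f : M ≃ₘ^1⟮𝓘(ℝ, E), 𝓘(ℝ, E)⟯ M) (n : ℤ) :
    ContMDiff 𝓘(ℝ, E) 𝓘(ℝ, E) 1 ⇑((f.toEquiv : Equiv.Perm M) ^ n) := by
  induction n using Int.induction_on with
  | zero => exact contMDiff_id
  | succ n ih =>
    rw [zpow_add, zpow_one]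
    exact ih.comp f.contMDiff
  | pred n ih =>
    rw [sub_eq_add_neg, zpow_add, zpow_neg_one]
    exact ih.comp f.symm.contMDiff

omit [IsManifold 𝓘(ℝ, E) 1 M] in
theorem PreservesField.zpow {f : M ≃ₘ^1⟮𝓘(ℝ, E), 𝓘(ℝ, E)⟯ M}
    (hS : ∀ x, (S x).map (mfderiv 𝓘(ℝ, E) 𝓘(ℝ, E) f x).toLinearMap = S (f x)) (n : ℤ) :
    PreservesField ⇑((f.toEquiv : Equiv.Perm M) ^ n) S := by
  have df := f.contMDiff.mdifferentiable one_ne_zero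
  have df' := f.symm.contMDiff.mdifferentiable one_ne_zero
  have hf : PreservesField f S := fun x s hs => hS x ▸ Submodule.mem_map_of_mem hs
  have hf' : PreservesField f.symm S :=
    PreservesField.of_leftInverse hS df df' f.symm_apply_apply f.surjective
  induction n using Int.induction_on with
  | zero => exact PreservesField.id
  | succ n ih =>
    rw [zpow_add, zpow_one]
    exact ih.comp hf ((f.contMDiff_zpow _).mdifferentiable one_ne_zero) df
  | pred n ih =>
    rw [sub_eq_add_neg, zpow_add, zpow_neg_one]
    exact ih.comp hf' ((f.contMDiff_zpow _).mdifferentiable one_ne_zero) df'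

end

section

variable [FiniteDimensional ℝ E] {S U : ∀ x : M, Submodule ℝ (TangentSpace 𝓘(ℝ, E) x)}
  (hSU : ∀ x, IsCompl (S x) (U x))

variable (E) in
/-- The derivative of `h` at `p`, read in the charts at `a` and `b`. -/
noncomputable def derivInCharts (h : M → M) (a b p : M) : E →L[ℝ] E :=
  chartDeriv E b (h p) ∘L mfderiv 𝓘(ℝ, E) 𝓘(ℝ, E) h p ∘L chartDerivSymm E a p

omit [IsManifold 𝓘(ℝ, E) 1 M] [FiniteDimensional ℝ E] in
theorem projection_mfderiv {h : M → M} (hS : PreservesField h S) (hU : PreservesField h U) (p : M)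
    (w : TangentSpace 𝓘(ℝ, E) p) :
    (S (h p)).projection (U (h p)) (hSU _) (mfderiv 𝓘(ℝ, E) 𝓘(ℝ, E) h p w) =
      mfderiv 𝓘(ℝ, E) 𝓘(ℝ, E) h p ((S p).projection (U p) (hSU p) w) := by
  have h1 := hS p _ (Submodule.projection_apply_mem (hSU p) w)
  have h2 := hU p _ (Submodule.sub_projection_mem (hSU p) w)
  rw [map_sub] at h2
  have h3 := (Submodule.projection_apply_eq_zero_iff (hSU (h p))).2 h2
  rw [map_sub, Submodule.projection_apply_of_mem_left (hSU (h p)) h1] at h3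
  exact sub_eq_zero.1 h3

theorem chartProj_comp_derivInCharts {h : M → M} (hS : PreservesField h S)
    (hU : PreservesField h U) {a b p : M} (ha : p ∈ (chartAt E a).source)
    (hb : h p ∈ (chartAt E b).source) :
    chartProj hSU b (h p) ∘L derivInCharts E h a b p =
      derivInCharts E h a b p ∘L chartProj hSU a p := by
  ext v
  simp only [derivInCharts, ContinuousLinearMap.comp_apply]
  rw [chartProj_chartDeriv hSU hb, projection_mfderiv hSU hS hU, chartDerivSymm_chartProj hSU ha]

variable [RiemannianBundle (fun x : M => TangentSpace 𝓘(ℝ, E) x)]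

/-- Commuting the projection past the derivative puts the vector in `S p` before `h` acts, so the
contraction `κ` applies. The three factors `C` come from the projection and the two changes of
chart. -/
theorem norm_chartProj_comp_derivInCharts_le {h : M → M} (hS : PreservesField h S)
    (hU : PreservesField h U) {a b p : M} (ha : p ∈ (chartAt E a).source)
    (hb : h p ∈ (chartAt E b).source) {C κ : ℝ} (hC : 0 ≤ C) (hκ : 0 ≤ κ)
    (h1 : ‖chartDeriv E b (h p)‖ ≤ C) (h2 : ‖chartDerivSymm E a p‖ ≤ C)
    (h3 : ‖chartProj hSU a p‖ ≤ C)
    (h4 : ∀ s ∈ S p, ‖mfderiv 𝓘(ℝ, E) 𝓘(ℝ, E) h p s‖ ≤ κ * ‖s‖) :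
    ‖chartProj hSU b (h p) ∘L derivInCharts E h a b p‖ ≤ C ^ 3 * κ := by
  rw [chartProj_comp_derivInCharts hSU hS hU ha hb]
  refine ContinuousLinearMap.opNorm_le_bound _ (by positivity) fun v => ?_
  simp only [derivInCharts, ContinuousLinearMap.comp_apply]
  have hs : chartDerivSymm E a p (chartProj hSU a p v) ∈ S p := by
    rw [chartDerivSymm_chartProj hSU ha]
    exact Submodule.projection_apply_mem (hSU p) _
  have e1 := (chartProj hSU a p).le_of_opNorm_le h3 v
  have e2 := (chartDerivSymm E a p).le_of_opNorm_le_of_le h2 e1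
  have e3 := (h4 _ hs).trans (mul_le_mul_of_nonneg_left e2 hκ)
  have e4 := (chartDeriv E b (h p)).le_of_opNorm_le_of_le h1 e3
  calc _ ≤ _ := e4
    _ = _ := by ring

/-- Near `a`, the chart at `a` distorts norms and splittings by at most `C`. -/
def IsControlledAt (a : M) (C : ℝ) (x : M) : Prop :=
  x ∈ (chartAt E a).source ∧ ‖chartDeriv E a x‖ ≤ C ∧ ‖chartDerivSymm E a x‖ ≤ C ∧
    ‖chartProj hSU a x‖ ≤ C ∧ ‖1 - chartProj hSU a x‖ ≤ C

theorem exists_eventually_isControlledAt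
    [IsContinuousRiemannianBundle E (fun x : M => TangentSpace 𝓘(ℝ, E) x)]
    (hS : IsContinuousDistribution S) (hU : IsContinuousDistribution U) (a : M) :
    ∃ C : ℝ, ∀ᶠ x in 𝓝 a, IsControlledAt hSU a C x := by
  obtain ⟨C₁, -, h1⟩ := eventually_norm_trivializationAt_lt E
    (fun x : M => TangentSpace 𝓘(ℝ, E) x) a
  obtain ⟨C₂, -, h2⟩ := eventually_norm_symmL_trivializationAt_lt E
    (fun x : M => TangentSpace 𝓘(ℝ, E) x) a
  have hc := continuousAt_chartProj hSU hS hU (mem_chart_source E a)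
  have h3 := hc.norm.eventually_lt_const (lt_add_one _)
  have h4 := (continuousAt_const.sub hc : ContinuousAt (fun x => 1 - chartProj hSU a x) a).norm
    |>.eventually_lt_const (lt_add_one _)
  refine ⟨max (max C₁ C₂) (max (‖chartProj hSU a a‖ + 1) (‖1 - chartProj hSU a a‖ + 1)), ?_⟩
  filter_upwards [h1, h2, h3, h4, (chartAt E a).open_source.mem_nhds (mem_chart_source E a)]
    with x h1 h2 h3 h4 h5
  refine ⟨h5, h1.le.trans ?_, h2.le.trans ?_, h3.le.trans ?_, h4.le.trans ?_⟩ <;> simp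

/-- The cover and `C` depend on the splitting and the charts alone, so the iterate can be chosen
after them. -/
theorem exists_finite_controlled_cover [CompactSpace M]
    [IsContinuousRiemannianBundle E (fun x : M => TangentSpace 𝓘(ℝ, E) x)]
    (hS : IsContinuousDistribution S) (hU : IsContinuousDistribution U) :
    ∃ (t : Finset M) (W : M → Set M) (C : ℝ), 0 ≤ C ∧ (∀ a, IsCompact (W a)) ∧
      (∀ x, ∃ a ∈ t, x ∈ W a) ∧ ∀ a ∈ t, ∀ x ∈ W a, IsControlledAt hSU a C x := by
  choose C hC using exists_eventually_isControlledAt hSU hS hU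
  choose W hW hWc using fun a => (compact_basis_nhds a).mem_iff.1 (hC a)
  obtain ⟨t, ht⟩ := isCompact_univ.elim_nhds_subcover W fun a _ => (hW a).1
  obtain ⟨D, hD⟩ := (t.image C).exists_le
  refine ⟨t, W, max D 0, le_max_right _ _, fun a => (hW a).2, fun x => ?_, fun a ha x hx => ?_⟩
  · simpa using ht.2 (mem_univ x)
  · obtain ⟨h1, h2, h3, h4, h5⟩ := hWc a hx
    have : C a ≤ max D 0 := (hD _ (Finset.mem_image_of_mem C ha)).trans (le_max_left _ _)
    exact ⟨h1, h2.trans this, h3.trans this, h4.trans this, h5.trans this⟩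

end

end

/-- The `n`-th iterate of a homeomorphism. -/
def Homeomorph.iterateZ {X : Type*} [TopologicalSpace X] (f : X ≃ₜ X) (n : ℤ) : X ≃ₜ X where
  toEquiv := (f.toEquiv : Equiv.Perm X) ^ n
  continuous_toFun := f.continuous_toEquiv_zpow n
  continuous_invFun := by
    have := f.continuous_toEquiv_zpow (-n)
    rw [zpow_neg] at this
    exact this

theorem HasStrictFDerivAt.comp_eq_one_of_eventually {E : Type*} [NormedAddCommGroup E]
    [NormedSpace ℝ E] {F G : E → E} {B D : E →L[ℝ] E} {a : E}
    (hF : HasStrictFDerivAt F B a) (hG : HasStrictFDerivAt G D (F a))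
    (h : ∀ᶠ v in 𝓝 a, G (F v) = v) : D ∘L B = 1 :=
  (hG.hasFDerivAt.comp a hF.hasFDerivAt).unique
    ((hasFDerivAt_id a).congr_of_eventuallyEq h)

/-! ### Anosov diffeomorphisms are expansive and have shadowing -/

section

variable {E : Type*} [NormedAddCommGroup E] [NormedSpace ℝ E] [FiniteDimensional ℝ E]
  {M : Type*} [EMetricSpace M] [CompactSpace M] [ChartedSpace E M] [IsManifold 𝓘(ℝ, E) 1 M]
  [RiemannianBundle (fun x : M => TangentSpace 𝓘(ℝ, E) x)]
  [IsContinuousRiemannianBundle E (fun x : M => TangentSpace 𝓘(ℝ, E) x)]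

/-- A large iterate of an Anosov diffeomorphism has a hyperbolic atlas. -/
theorem IsAnosov.exists_hyperbolicAtlas {f : M ≃ₘ^1⟮𝓘(ℝ, E), 𝓘(ℝ, E)⟯ M} (hf : IsAnosov f) :
    ∃ (N : ℕ) (t : Finset M) (W : t → Set M) (P : t → M → E →L[ℝ] E), 0 < N ∧
      HyperbolicAtlas (f.toHomeomorph.iterateZ N) (fun a : t => chartAt E a.1) W P := by
  obtain ⟨K, lam, hK, hlam0, hlam1, S, U, hS, hU, hSU, hfS, hfU, hcS, hcU⟩ := hf
  obtain ⟨t, W, C, hC, hW, hcov, hctl⟩ := exists_finite_controlled_cover hSU hS hU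
  -- With `C` fixed, the distortion `C ^ 3 * K` is absorbed by a large power of `lam`.
  have hlim : Tendsto (fun n : ℕ => C ^ 3 * (K * lam ^ n)) atTop (𝓝 (C ^ 3 * (K * 0))) :=
    ((tendsto_pow_atTop_nhds_zero_of_lt_one hlam0.le hlam1).const_mul _).const_mul _
  obtain ⟨N, hN, hN0⟩ := ((hlim.eventually_lt_const (u := 1 / 4) (by simp)).and
    (eventually_gt_atTop 0)).exists
  refine ⟨N, t, fun a => W a, fun a => chartProj hSU a, hN0, fun a => hW a, fun a x hx =>
    (hctl a a.2 x hx).1, fun x => ?_, fun a x hx =>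
    continuousAt_chartProj hSU hS hU (hctl a a.2 x hx).1, fun a x hx =>
    chartProj_comp_self hSU (hctl a a.2 x hx).1, fun a b x hx hgx => ?_⟩
  · obtain ⟨a, ha, hx⟩ := hcov x
    exact ⟨⟨a, ha⟩, hx⟩
  set g := f.toHomeomorph.iterateZ N
  have gS : ∀ n : ℤ, PreservesField ⇑((f.toEquiv : Equiv.Perm M) ^ n) S := PreservesField.zpow hfS
  have gU : ∀ n : ℤ, PreservesField ⇑((f.toEquiv : Equiv.Perm M) ^ n) U := PreservesField.zpow hfU
  have hsymm : ⇑g.symm = ⇑((f.toEquiv : Equiv.Perm M) ^ (-N : ℤ)) := by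
    rw [zpow_neg]
    rfl
  have cg : ContMDiff 𝓘(ℝ, E) 𝓘(ℝ, E) 1 g := f.contMDiff_zpow N
  have cg' : ContMDiff 𝓘(ℝ, E) 𝓘(ℝ, E) 1 g.symm := hsymm ▸ f.contMDiff_zpow _
  have gS' : PreservesField g.symm S := hsymm ▸ gS (-N)
  have gU' : PreservesField g.symm U := hsymm ▸ gU (-N)
  obtain ⟨ha, ha1, ha2, ha3, ha4⟩ := hctl a a.2 x hx
  obtain ⟨hb, hb1, hb2, hb3, hb4⟩ := hctl b b.2 _ hgx
  have hback : ∀ {p : M → Prop}, p x → p (g.symm (g x)) := fun {p} h => by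
    rwa [g.symm_apply_apply]
  have hκ : 0 ≤ K * lam ^ N := by positivity
  have dB := hasStrictFDerivAt_in_charts cg ha hb
  have dD := hasStrictFDerivAt_in_charts cg' hb (hback (p := fun z => z ∈ (chartAt E a.1).source) ha)
  refine ⟨derivInCharts E g a b x, derivInCharts E g.symm b a (g x), dB, dD, ?_,
    chartProj_comp_derivInCharts hSU (gS N) (gU N) ha hb, ?_, ?_⟩
  · refine dB.comp_eq_one_of_eventually (G := chartAt E a.1 ∘ g.symm ∘ (chartAt E b.1).symm) ?_ ?_
    · rw [Function.comp_apply, Function.comp_apply, (chartAt E a.1).left_inv ha]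
      exact dD
    · have hx' := (chartAt E a.1).map_source ha
      have hc : ContinuousAt (fun v => g ((chartAt E a.1).symm v)) (chartAt E a.1 x) :=
        g.continuous.continuousAt.comp ((chartAt E a.1).continuousAt_symm hx')
      have hsrc : (chartAt E b.1).source ∈ 𝓝 (g ((chartAt E a.1).symm (chartAt E a.1 x))) := by
        rw [(chartAt E a.1).left_inv ha]
        exact (chartAt E b.1).open_source.mem_nhds hb
      filter_upwards [hc.eventually hsrc, (chartAt E a.1).open_target.mem_nhds hx'] with v hv hv'
      simp only [Function.comp_apply]
      rw [(chartAt E b.1).left_inv hv, g.symm_apply_apply, (chartAt E a.1).right_inv hv']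
  · refine (norm_chartProj_comp_derivInCharts_le hSU (gS N) (gU N) ha hb hC hκ hb1 ha2 ha3
      fun s hs => ?_).trans_lt hN
    have h := hcS x N (Int.natCast_nonneg N) s hs
    rw [zpow_natCast lam] at h
    exact h
  -- The same bound with the two fields exchanged and `g` replaced by its inverse, which contracts
  -- `U`.
  · have key := norm_chartProj_comp_derivInCharts_le (fun x => (hSU x).symm) gU' gS' hb
      (hback (p := fun z => z ∈ (chartAt E a.1).source) ha) hC hκ
      (hback (p := fun z => ‖chartDeriv E a.1 z‖ ≤ C) ha1) hb2
      (by rwa [chartProj_symm hSU hb]) fun u hu => by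
        rw [hsymm]
        have h := hcU (g x) (-N) (by simp) u hu
        rw [neg_neg, zpow_natCast lam] at h
        exact h
    rw [chartProj_symm hSU (hback (p := fun z => z ∈ (chartAt E a.1).source) ha),
      g.symm_apply_apply] at key
    exact key.trans_lt hN

theorem IsAnosov.exists_isExpansivityConstant {f : M ≃ₘ^1⟮𝓘(ℝ, E), 𝓘(ℝ, E)⟯ M}
    (hf : IsAnosov f) : ∃ ρ : ℝ, IsExpansivityConstant f.toEquiv ρ := by
  obtain ⟨N, t, W, P, -, H⟩ := hf.exists_hyperbolicAtlas
  obtain ⟨ρ, hρ⟩ := H.exists_isExpansivityConstant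
  exact ⟨ρ, hρ.of_zpow⟩

theorem IsAnosov.exists_pseudoOrbitsShadowed {f : M ≃ₘ^1⟮𝓘(ℝ, E), 𝓘(ℝ, E)⟯ M}
    (hf : IsAnosov f) {β : ℝ} (hβ : 0 < β) :
    ∃ α : ℝ, 0 < α ∧ PseudoOrbitsShadowed f.toEquiv α β := by
  obtain ⟨N, t, W, P, hN, H⟩ := hf.exists_hyperbolicAtlas
  have := FiniteDimensional.complete ℝ E
  refine exists_pseudoOrbitsShadowed_of_pow
    (CompactSpace.uniformContinuous_of_continuous f.continuous) hN (fun β hβ => ?_) hβ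
  obtain ⟨α, hα, h⟩ := H.exists_pseudoOrbitsShadowed hβ
  have e : (f.toHomeomorph.iterateZ N).toEquiv = (f.toEquiv : Equiv.Perm M) ^ N :=
    zpow_natCast _ N
  exact ⟨α, hα, e ▸ h⟩

end

theorem mainTheorem3
    {E : Type*} [NormedAddCommGroup E] [NormedSpace ℝ E] [FiniteDimensional ℝ E]
    {M : Type*} [EMetricSpace M] [CompactSpace M] [ChartedSpace E M]
    [IsManifold 𝓘(ℝ, E) 1 M]
    [RiemannianBundle (fun x : M => TangentSpace 𝓘(ℝ, E) x)]
    [IsContinuousRiemannianBundle E (fun x : M => TangentSpace 𝓘(ℝ, E) x)]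
    [IsRiemannianManifold 𝓘(ℝ, E) M]
    (f : M ≃ₘ^1⟮𝓘(ℝ, E), 𝓘(ℝ, E)⟯ M) (hf : IsAnosov f) :
    -- there is a constant of expansivity, and for every such constant and every small `β` ...
    (∃ ρ : ℝ, IsExpansivityConstant f.toEquiv ρ) ∧
    ∀ ρ : ℝ, IsExpansivityConstant f.toEquiv ρ → ∀ β : ℝ, 0 < β → β < ρ / 2 →
    -- ... the choice of `α` is possible, and for every such choice ...
    (∃ α : ℝ, 0 < α ∧ PseudoOrbitsShadowed f.toEquiv α β) ∧
    ∀ α : ℝ, 0 < α → PseudoOrbitsShadowed f.toEquiv α β →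
    -- ... the choice of `γ` is possible, and for every such choice ...
    (∃ γ : ℝ, 0 < γ ∧ γ < min β (α / 2) ∧
      ∀ x y : M, edist x y < ENNReal.ofReal γ → edist (f x) (f y) < ENNReal.ofReal (α / 2)) ∧
    ∀ γ : ℝ, 0 < γ → γ < min β (α / 2) →
      (∀ x y : M, edist x y < ENNReal.ofReal γ →
        edist (f x) (f y) < ENNReal.ofReal (α / 2)) →
    -- ... finite `γ`-dense sets exist, and for every such set `P` ...
    (∃ P : Finset M, IsGammaDense P γ) ∧
    ∀ P : Finset M, IsGammaDense P γ →
    -- ... every element of `Σ(P)` is `β`-shadowed by the orbit of exactly one point, and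
    -- the map `θ` so defined is a semiconjugacy of `f` with the shift restricted to `Σ(P)`.
      (∀ q : pseudoOrbitSpace f α P,
        ∃! x : M, Shadows β (fullOrbit f.toEquiv x) (fun n => (q.1 n : M))) ∧
      ∃ θ : pseudoOrbitSpace f α P → M,
        (∀ q : pseudoOrbitSpace f α P,
          Shadows β (fullOrbit f.toEquiv (θ q)) (fun n => (q.1 n : M))) ∧
        IsSemiconjugacy f.toHomeomorph (shiftOn f α P) θ := by

  have hunif : UniformContinuous f := CompactSpace.uniformContinuous_of_continuous f.continuous
  refine ⟨hf.exists_isExpansivityConstant, fun ρ hρ β hβ hβρ =>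
    ⟨hf.exists_pseudoOrbitsShadowed hβ, fun α hα hsh => ⟨?_, fun γ hγ hγβ hfγ =>
      ⟨exists_isGammaDense hγ, fun P hP => ?_⟩⟩⟩⟩
  · obtain ⟨δ, hδ, h⟩ := hunif.exists_ofReal_edist (half_pos hα)
    have hm : 0 < min β (α / 2) := lt_min hβ (half_pos hα)
    -- The second entry is halved to keep the required inequality `γ < min β (α / 2)` strict.
    refine ⟨min δ (min β (α / 2) / 2), lt_min hδ (half_pos hm),
      (min_le_right _ _).trans_lt (half_lt_self hm), fun x y hxy => h x y ?_⟩
    exact hxy.trans_le (ENNReal.ofReal_le_ofReal (min_le_left _ _))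
  · choose θ hθ using fun q : pseudoOrbitSpace f α P => hsh _ q.2
    exact ⟨fun q => ⟨θ q, hθ q, fun x hx => hρ.shadows_unique hβ hβρ hx (hθ q)⟩, θ, hθ,
      isSemiconjugacy_of_shadows f.toHomeomorph hρ hβ hβρ hγβ hα hfγ hP hθ⟩
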